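/- **Kernels.** For a function $\varsigma$ on $\mathbb{R}^2$ and $j=(j_1,j_2)\in\mathbb{N}^2$ (with $0\in\mathbb{N}$) put $$\varsigma^{(2^{j})}(s,t)=2^{j_1+j_2}\,\varsigma(2^{j_1}s,2^{j_2}t).$$ For $a_0>0$ let $\mathcal{K}(a_0)$, the class of two-parameter product kernels on $\mathbb{R}\times\mathbb{R}$ supported in the disc $B(a_0)=\{(s,t)\in\mathbb{R}^2: s^2+t^2<a_0^2\}$, be the set of all complex distributions $K$ on $\mathbb{R}^2$ of the form $$K=\sum_{j\in\mathbb{N}^2}\varsigma_j^{(2^{j})}\qquad\text{(convergence in the sense of distributions)},$$ where $\{\varsigma_j\}_{j\in\mathbb{N}^2}$ is a bounded subset of $C_c^\infty(B(a_0))$ (supports in a common compact subset of $B(a_0)$, and each derivative bounded uniformly in $j$) such that $\int\varsigma_j(s,t)\,ds=0$ for all $t$ whenever $j_1\neq 0$, and $\int\varsigma_j(s,t)\,dt=0$ for all $s$ whenever $j_2\neq0$. **Operators.** Let $p(s,t)=\sum_{(e,f)}c_{(e,f)}s^et^f$ be a polynomial with real coefficients and $c_{(0,0)}=0$. For a compactly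 supported distribution $K$ on $\mathbb{R}^2$ and $f\in C_c^\infty(\mathbb{R})$ put $$T_Kf(x)=\int f(x-p(s,t))\,K(s,t)\,ds\,dt,\qquad x\in\mathbb{R},$$ meaning that $K$ is applied to the smooth function $(s,t)\mapsto f(x-p(s,t))$. We say that $T_K$ is bounded on $L^2$ if there is $C<\infty$ with $\|T_Kf\|_{L^2(\mathbb{R})}\le C\|f\|_{L^2(\mathbb{R})}$ for all $f\in C_c^\infty(\mathbb{R})$. **Theorem.** Assume that $p$ contains a pure power of $s$ and a pure power of $t$, and let $a\ge1$ be the least integer with $c_{(a,0)}\ne0$ and $b\geq 1$ the least integer with $c_{(0,b)}\neq0$. Then the following are equivalent: 1. $T_K$ is bounded on $L^2$ for every product kernel $K$ of sufficiently small support, i.e. there is $a_0\in(0,1]$ such that $T_K$ is bounded on $L^2$ for every $K\in\mathcal{K}(a_0)$; 2. every $(e,f)\in\mathbb{N}^2$ with $c_{(e,f)}\ne0$ lies on or above the line through $(a,0)$ and $(0,b)$, i.e. $\frac ea+\frac fb\ge1$. -/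

import Mathlib

open MeasureTheory TopologicalSpace
open scoped Distributions ContDiff ENNReal NNReal

namespace TransInv

/-- The polynomial `p(s,t)` as a function on `ℝ²`. -/
noncomputable def polyFun (p : MvPolynomial (Fin 2) ℝ) (z : ℝ × ℝ) : ℝ :=
  MvPolynomial.eval ![z.1, z.2] p

/-- The coefficient `c_(e,f)` of `s ^ e * t ^ f` in `p`. -/
noncomputable def coeffAt (p : MvPolynomial (Fin 2) ℝ) (e f : ℕ) : ℝ :=
  p.coeff (Finsupp.single 0 e + Finsupp.single 1 f)

theorem contDiff_polyFun (p : MvPolynomial (Fin 2) ℝ) : ContDiff ℝ ∞ (polyFun p) := by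
  unfold polyFun
  induction p using MvPolynomial.induction_on with
  | C c => simpa using contDiff_const
  | add p q hp hq => simpa using hp.add hq
  | mul_X p i hp =>
    have hi : ContDiff ℝ ∞ (fun z : ℝ × ℝ => (![z.1, z.2] : Fin 2 → ℝ) i) := by
      fin_cases i
      · simpa using contDiff_fst
      · simpa using contDiff_snd
    simpa using hp.mul hi

/-- The `L¹`-normalised two-parameter dyadic dilate
`ς^(2^j)(s,t) = 2^(j₁+j₂) ς(2^j₁ s, 2^j₂ t)`. -/
noncomputable def dilate (j : ℕ × ℕ) (ς : ℝ × ℝ → ℂ) (z : ℝ × ℝ) : ℂ :=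
  2 ^ (j.1 + j.2) * ς (2 ^ j.1 * z.1, 2 ^ j.2 * z.2)

/-- `{ς_j}` is a bounded subset of `C_c^∞(B²(a₀))` (supports in a common compact subset of the
open Euclidean disc of radius `a₀`, every derivative bounded uniformly in `j`), and `ς_j` has
vanishing integral in the `μ`-th variable unless `j_μ = 0`. -/
structure IsKernelFamily (a₀ : ℝ) (ς : ℕ × ℕ → ℝ × ℝ → ℂ) : Prop where
  smooth : ∀ j, ContDiff ℝ ∞ (ς j)
  supp : ∃ r : ℝ, 0 ≤ r ∧ r < a₀ ∧ ∀ j z, ς j z ≠ 0 → z.1 ^ 2 + z.2 ^ 2 ≤ r ^ 2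
  bounded : ∀ n : ℕ, ∃ C : ℝ, ∀ j z, ‖iteratedFDeriv ℝ n (ς j) z‖ ≤ C
  cancel_fst : ∀ j : ℕ × ℕ, j.1 ≠ 0 → ∀ t : ℝ, ∫ s : ℝ, ς j (s, t) = 0
  cancel_snd : ∀ j : ℕ × ℕ, j.2 ≠ 0 → ∀ s : ℝ, ∫ t : ℝ, ς j (s, t) = 0

/-- The product kernels on `ℝ × ℝ` supported in the disc of radius `a₀`, that is, the class
`𝒦(2, ((1,0),(0,1)), a₀, [0,1]²)`: the complex distributions `K` of the form
`K = ∑_j ς_j^(2^j)`, with convergence in the sense of distributions. -/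
def IsProductKernel (a₀ : ℝ) (K : 𝓓'((⊤ : Opens (ℝ × ℝ)), ℂ)) : Prop :=
  ∃ ς : ℕ × ℕ → ℝ × ℝ → ℂ, IsKernelFamily a₀ ς ∧
    ∀ φ : 𝓓((⊤ : Opens (ℝ × ℝ)), ℝ),
      HasSum (fun j : ℕ × ℕ => ∫ z : ℝ × ℝ, (φ z : ℂ) * dilate j (ς j) z) (K φ)

/-- The complex-linear extension of a distribution to complex-valued test functions. -/
noncomputable def pairing (K : 𝓓'((⊤ : Opens (ℝ × ℝ)), ℂ)) (φ : 𝓓((⊤ : Opens (ℝ × ℝ)), ℂ)) : ℂ :=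
  K (TestFunction.postcompCLM Complex.reCLM φ)
    + Complex.I * K (TestFunction.postcompCLM Complex.imCLM φ)

/-- A fixed smooth cutoff, equal to `1` on `[-1,1]²` and supported in `[-2,2]²`. -/
noncomputable def cutoff : ContDiffBump (0 : ℝ × ℝ) := ⟨1, 2, one_pos, one_lt_two⟩

/-- The test function `(s,t) ↦ χ(s,t) f(x - p(s,t))`, where `χ` is the fixed cutoff. -/
noncomputable def translate (p : MvPolynomial (Fin 2) ℝ) (f : 𝓓((⊤ : Opens ℝ), ℂ)) (x : ℝ) :
    𝓓((⊤ : Opens (ℝ × ℝ)), ℂ) where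
  toFun z := cutoff z • f (x - polyFun p z)
  contDiff' := cutoff.contDiff.smul
    (f.contDiff.comp (contDiff_const.sub (contDiff_polyFun p)))
  hasCompactSupport' := cutoff.hasCompactSupport.smul_right
  tsupport_subset' := fun _ _ => trivial

/-- `T_K f(x) = ∫ f(x - p(s,t)) K(s,t) ds dt`, the distribution `K` being applied to the smooth
function `(s,t) ↦ f(x - p(s,t))`. This makes sense for compactly supported `K`, through a cutoff
which is `1` near the support of `K`; the fixed cutoff is of this kind for every `K` supported
in the open unit disc. -/
noncomputable def opT (p : MvPolynomial (Fin 2) ℝ) (K : 𝓓'((⊤ : Opens (ℝ × ℝ)), ℂ))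
    (f : 𝓓((⊤ : Opens ℝ), ℂ)) (x : ℝ) : ℂ :=
  pairing K (translate p f x)

/-- An operator defined on `C_c^∞(ℝ)` is bounded on `L²(ℝ)`. -/
def IsL2Bounded (T : 𝓓((⊤ : Opens ℝ), ℂ) → ℝ → ℂ) : Prop :=
  ∃ C : ℝ≥0, ∀ f : 𝓓((⊤ : Opens ℝ), ℂ),
    MemLp (T f) 2 volume ∧ eLpNorm (T f) 2 volume ≤ C * eLpNorm f 2 volume

end TransInv

/-! `T_K` commutes with translations, so its boundedness on L² is boundedness of its Fourier
multiplier, the sum over j of m_j(ξ) = ∫ ς_j^(2^j) exp(iξp). Rescaling turns m_j into an oscillatory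
integral `osc` with an amplitude of fixed size and phase ξ p(2^(-j₁)s, 2^(-j₂)t). Put X = |ξ| 2^(-a
j₁) and Y = |ξ| 2^(-b j₂), the sizes of the two pure powers in this phase.

Sufficiency. If no exponent lies below the line, every monomial of the phase is O(max(X, Y)). Van
der Corput's lemma in the dominant variable then gives decay max(X, Y)^(-σ)
(`exists_norm_osc_le_decay`); small support keeps the relevant derivative of the phase away from
zero. When j₁ ≠ 0 and X ≤ 1, cancellation in s gives a gain X^θ (1 + Y) (`norm_osc_le_of_cancel`).
Interpolation yields min(X, 1/X)^κ, and likewise for Y; a geometric mean gives both gains at once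
(`exists_norm_osc_le_gain`). The product is summable over j uniformly in ξ, and Plancherel and Fatou
conclude (`isL2Bounded_opT`).

Necessity. If some exponent lies below the line, the Newton polygon has a vertex e₀ strictly below
it, hence off both axes (`exists_strict_vertex`). For each N there are N scales j with the same
value L of e₀·j, at which all other monomials are smaller by 2^(-N) (`exists_scales`). At frequency
μ 2^L the corresponding N terms m_j are all close to one nonzero number, so the sums of |m_j| are
unbounded in ξ. The terms m_j might cancel for one given kernel, but multiplying ς_j by bounded
coefficients ε_j again gives a product kernel. If all these kernels gave bounded operators, the
uniform boundedness principle on bounded sequences would bound the sums of |m_j|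
(`exists_sum_norm_le_of_forall_bounded`). -/

/-! ### Van der Corput's lemma for polynomial phases. -/

namespace TransInv

open Polynomial Set

/-- The first step of van der Corput's lemma: a phase without critical points. -/
theorem norm_integral_exp_le_of_deriv (q : ℝ[X]) {u v Λ c : ℝ} (huv : u ≤ v) (hlen : v - u ≤ 2)
    (hΛ : 0 < Λ) (hc : 0 < c) (hc1 : c ≤ 1)
    (h2 : ∀ s ∈ Icc u v, |q.derivative.derivative.eval s| ≤ Λ)
    (h1 : ∀ s ∈ Icc u v, c * Λ ≤ |q.derivative.eval s|) :
    ‖∫ s in u..v, Complex.exp (Complex.I * (q.eval s : ℝ))‖ ≤ 4 / (Λ * c ^ 2) := by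
  set E : ℝ → ℂ := fun s => Complex.exp (Complex.I * (q.eval s : ℝ)) with hE
  have hcΛ : 0 < c * Λ := by positivity
  have hne : ∀ s ∈ Icc u v, ((q.derivative.eval s : ℝ) : ℂ) ≠ 0 := by
    intro s hs h0
    have h0' : q.derivative.eval s = 0 := by exact_mod_cast h0
    have := h1 s hs
    rw [h0', abs_zero] at this
    linarith
  have hEn : ∀ s, ‖E s‖ = 1 := fun s => Complex.norm_exp_I_mul_ofReal _
  have hder : ∀ s, HasDerivAt E (E s * (Complex.I * (q.derivative.eval s : ℝ))) s := fun s =>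
    (((q.hasDerivAt s).ofReal_comp).const_mul Complex.I).cexp
  have hder2 : ∀ s, HasDerivAt (fun s => ((q.derivative.eval s : ℝ) : ℂ))
      ((q.derivative.derivative.eval s : ℝ) : ℂ) s := fun s =>
    (q.derivative.hasDerivAt s).ofReal_comp
  have hEc : Continuous E := by fun_prop
  -- Integration by parts: E = (E / (i q'))' + R. The bound on q'' controls R, in place of the usual
  -- monotonicity of q'.
  set R : ℝ → ℂ := fun s =>
    E s * ((q.derivative.derivative.eval s : ℝ) : ℂ) / (Complex.I * (q.derivative.eval s : ℝ) ^ 2)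
    with hR
  have hRc : ContinuousOn R (Icc u v) := by
    refine ContinuousOn.div (by fun_prop) (by fun_prop) ?_
    intro s hs
    exact mul_ne_zero Complex.I_ne_zero (pow_ne_zero _ (hne s hs))
  have hF : ∀ s ∈ uIcc u v, HasDerivAt (fun s => E s / (Complex.I * (q.derivative.eval s : ℝ)))
      (E s - R s) s := by
    intro s hs
    rw [uIcc_of_le huv] at hs
    have h0 := hne s hs
    refine ((hder s).div ((hder2 s).const_mul Complex.I)
      (mul_ne_zero Complex.I_ne_zero h0)).congr_deriv ?_
    simp only [hR]
    have hI := Complex.I_ne_zero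
    field_simp
  have hint1 : IntervalIntegrable E volume u v := hEc.intervalIntegrable _ _
  have hint2 : IntervalIntegrable R volume u v := by
    apply ContinuousOn.intervalIntegrable
    rwa [uIcc_of_le huv]
  have hftc := intervalIntegral.integral_eq_sub_of_hasDerivAt hF (hint1.sub hint2)
  rw [intervalIntegral.integral_sub hint1 hint2] at hftc
  have hmain : ∫ s in u..v, E s = (E v / (Complex.I * (q.derivative.eval v : ℝ))
      - E u / (Complex.I * (q.derivative.eval u : ℝ))) + ∫ s in u..v, R s := by
    rw [← hftc]; ring
  have hb : ∀ s ∈ Icc u v, ‖E s / (Complex.I * (q.derivative.eval s : ℝ))‖ ≤ 1 / (c * Λ) := by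
    intro s hs
    rw [norm_div, hEn, norm_mul, Complex.norm_I, one_mul, Complex.norm_real, Real.norm_eq_abs]
    exact one_div_le_one_div_of_le hcΛ (h1 s hs)
  have hRb : ‖∫ s in u..v, R s‖ ≤ (Λ / (c * Λ) ^ 2) * |v - u| := by
    apply intervalIntegral.norm_integral_le_of_norm_le_const
    intro s hs
    rw [uIoc_of_le huv] at hs
    have hs' : s ∈ Icc u v := ⟨hs.1.le, hs.2⟩
    simp only [hR]
    rw [norm_div, norm_mul, hEn, norm_mul, Complex.norm_I, one_mul, one_mul, norm_pow,
      Complex.norm_real, Complex.norm_real, Real.norm_eq_abs, Real.norm_eq_abs]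
    have := h1 s hs'
    have := h2 s hs'
    gcongr
  rw [hmain]
  have hlen' : |v - u| ≤ 2 := by rw [abs_of_nonneg (by linarith)]; exact hlen
  calc _ ≤ (1 / (c * Λ) + 1 / (c * Λ)) + (Λ / (c * Λ) ^ 2) * 2 := by
        refine (norm_add_le _ _).trans (add_le_add ((norm_sub_le _ _).trans (add_le_add
          (hb v ⟨huv, le_rfl⟩) (hb u ⟨le_rfl, huv⟩))) (hRb.trans ?_))
        gcongr
    _ = (2 * c + 2) / (Λ * c ^ 2) := by field_simp; ring
    _ ≤ 4 / (Λ * c ^ 2) := by gcongr; linarith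

/-- A function whose derivative is bounded below in absolute value grows linearly away from a
minimiser of its absolute value. -/
theorem exists_abs_sub_le_abs_eval (g : ℝ[X]) {u v m : ℝ} (huv : u ≤ v)
    (hg : ∀ s ∈ Icc u v, m ≤ |g.derivative.eval s|) :
    ∃ x₀ ∈ Icc u v, ∀ s ∈ Icc u v, m * |s - x₀| ≤ |g.eval s| := by
  obtain ⟨x₀, hx₀, hmin⟩ := isCompact_Icc.exists_isMinOn (nonempty_Icc.2 huv)
    (f := fun s => |g.eval s|) (by fun_prop)
  refine ⟨x₀, hx₀, fun s hs => ?_⟩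
  have hmv : ∀ x ∈ Icc u v, ∀ y ∈ Icc u v, m * |x - y| ≤ |g.eval x - g.eval y| := by
    have key : ∀ x ∈ Icc u v, ∀ y ∈ Icc u v, x < y → m * |x - y| ≤ |g.eval x - g.eval y| := by
      intro x hx y hy hxy
      obtain ⟨w, hw, hw'⟩ := exists_hasDerivAt_eq_slope (fun s => g.eval s)
        (fun s => g.derivative.eval s) hxy (by fun_prop) (fun s _ => g.hasDerivAt s)
      have h1 := hg w ⟨hx.1.trans hw.1.le, hw.2.le.trans hy.2⟩
      rw [hw', abs_div, le_div_iff₀ (by rw [abs_pos]; linarith)] at h1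
      rw [abs_sub_comm x, abs_sub_comm (g.eval x)]
      exact h1
    intro x hx y hy
    rcases lt_trichotomy x y with h | h | h
    · exact key x hx y hy h
    · simp [h]
    · rw [abs_sub_comm x, abs_sub_comm (g.eval x)]
      exact key y hy x hx h
  have h1 := hmv s hs x₀ hx₀
  have h2 : |g.eval x₀| ≤ |g.eval s| := hmin hs
  -- If g has a zero, then g(x₀) = 0 and the mean value bound suffices. Otherwise g has constant
  -- sign, so |g(s) - g(x₀)| = |g(s)| - |g(x₀)|.
  by_cases hz : ∃ z ∈ Icc u v, g.eval z = 0
  · obtain ⟨z, hz, hz0⟩ := hz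
    have : |g.eval x₀| ≤ |g.eval z| := hmin hz
    rw [hz0, abs_zero] at this
    have h0 : g.eval x₀ = 0 := abs_nonpos_iff.1 this
    rwa [h0, sub_zero] at h1
  · push Not at hz
    have hpc : IsPreconnected (Icc u v) := isPreconnected_Icc
    have hcont : ContinuousOn (fun s => g.eval s) (Icc u v) := by fun_prop
    have hsame : 0 < g.eval s * g.eval x₀ := by
      by_contra hcon
      push Not at hcon
      have : ∃ z ∈ Icc u v, g.eval z = 0 := by
        rcases mul_nonpos_iff.1 hcon with ⟨ha, hb⟩ | ⟨ha, hb⟩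
        · exact hpc.intermediate_value hx₀ hs hcont ⟨hb, ha⟩
        · exact hpc.intermediate_value hs hx₀ hcont ⟨ha, hb⟩
      obtain ⟨z, h, h'⟩ := this
      exact hz z h h'
    rcases pos_and_pos_or_neg_and_neg_of_mul_pos hsame with ⟨ha, hb⟩ | ⟨ha, hb⟩
    · rw [abs_of_pos ha, abs_of_pos hb] at h2
      rw [abs_of_nonneg (a := g.eval s - g.eval x₀) (by linarith)] at h1
      rw [abs_of_pos ha]; linarith
    · rw [abs_of_neg ha, abs_of_neg hb] at h2
      rw [abs_of_nonpos (a := g.eval s - g.eval x₀) (by linarith)] at h1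
      rw [abs_of_neg ha]; linarith

/-- A form of van der Corput's lemma with a free parameter `δ`. -/
theorem norm_integral_exp_le (k : ℕ) (q : ℝ[X]) {Λ δ : ℝ} (hΛ : 0 < Λ) (hδ : 0 < δ) (hδ1 : δ ≤ 1)
    {c : ℝ} (hc : 0 < c) (hc1 : c ≤ 1) {u v : ℝ} (huv : u ≤ v) (hlen : v - u ≤ 2)
    (h2 : ∀ s ∈ Icc u v, |q.derivative.derivative.eval s| ≤ Λ)
    (h1 : ∀ s ∈ Icc u v, c * Λ ≤ |(derivative^[k + 1] q).eval s|) :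
    ‖∫ s in u..v, Complex.exp (Complex.I * (q.eval s : ℝ))‖
      ≤ 4 ^ k * (δ + 4 / (Λ * (c * δ ^ k) ^ 2)) := by
  induction k generalizing c u v with
  | zero =>
    have := norm_integral_exp_le_of_deriv q huv hlen hΛ hc hc1 h2 h1
    simp only [pow_zero, mul_one, one_mul]
    linarith
  | succ k ih =>
    rw [Function.iterate_succ_apply'] at h1
    obtain ⟨x₀, hx₀, hgrow⟩ := exists_abs_sub_le_abs_eval _ huv h1
    set B : ℝ := 4 ^ k * (δ + 4 / (Λ * (c * δ ^ (k + 1)) ^ 2)) with hB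
    have hB0 : 0 ≤ B := by positivity
    have hpiece : ∀ u' v', u ≤ u' → u' ≤ v' → v' ≤ v → (∀ s ∈ Icc u' v', δ ≤ |s - x₀|) →
        ‖∫ s in u'..v', Complex.exp (Complex.I * (q.eval s : ℝ))‖ ≤ B := by
      intro u' v' hu hu'v' hv hs
      -- At distance at least δ from x₀ the derivative of one order less is at least cδΛ, so the
      -- induction hypothesis applies with cδ in place of c.
      have := ih (c := c * δ) (u := u') (v := v') (by positivity)
        (mul_le_one₀ hc1 hδ.le hδ1) hu'v' (by linarith)
        (fun s hs' => h2 s ⟨hu.trans hs'.1, hs'.2.trans hv⟩)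
        (fun s hs' => by
          refine le_trans ?_ (hgrow s ⟨hu.trans hs'.1, hs'.2.trans hv⟩)
          have := hs s hs'
          calc c * δ * Λ = c * Λ * δ := by ring
            _ ≤ _ := by gcongr)
      rw [hB]
      convert this using 6
      ring
    set E : ℝ → ℂ := fun s => Complex.exp (Complex.I * (q.eval s : ℝ)) with hE
    have hint : ∀ x y, IntervalIntegrable E volume x y := fun x y =>
      (by fun_prop : Continuous E).intervalIntegrable _ _
    set y₁ := max u (x₀ - δ)
    set y₂ := min v (x₀ + δ)
    have hy1 : u ≤ y₁ := le_max_left _ _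
    have hy1' : y₁ ≤ x₀ := max_le hx₀.1 (by linarith)
    have hy2 : y₂ ≤ v := min_le_left _ _
    have hy2' : x₀ ≤ y₂ := le_min hx₀.2 (by linarith)
    have hleft : ‖∫ s in u..y₁, E s‖ ≤ B := by
      rcases le_total u (x₀ - δ) with h | h
      · refine hpiece u y₁ le_rfl hy1 (by linarith) fun s hs => ?_
        have : y₁ = x₀ - δ := max_eq_right h
        rw [this] at hs
        rw [abs_sub_comm]
        exact le_trans (by linarith [hs.2]) (le_abs_self _)
      · have : y₁ = u := max_eq_left h
        simpa [this] using hB0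
    have hright : ‖∫ s in y₂..v, E s‖ ≤ B := by
      rcases le_total (x₀ + δ) v with h | h
      · refine hpiece y₂ v (by linarith) hy2 le_rfl fun s hs => ?_
        have : y₂ = x₀ + δ := min_eq_right h
        rw [this] at hs
        exact le_trans (by linarith [hs.1]) (le_abs_self _)
      · have : y₂ = v := min_eq_left h
        simpa [this] using hB0
    have hmid : ‖∫ s in y₁..y₂, E s‖ ≤ 2 * δ := by
      have : ‖∫ s in y₁..y₂, E s‖ ≤ 1 * |y₂ - y₁| :=
        intervalIntegral.norm_integral_le_of_norm_le_const fun s _ =>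
          (Complex.norm_exp_I_mul_ofReal _).le
      refine this.trans ?_
      rw [one_mul, abs_of_nonneg (by linarith)]
      have h3 : x₀ - δ ≤ y₁ := le_max_right _ _
      have h4 : y₂ ≤ x₀ + δ := min_le_right _ _
      linarith
    rw [← intervalIntegral.integral_add_adjacent_intervals (hint u y₁) (hint y₁ v),
      ← intervalIntegral.integral_add_adjacent_intervals (hint y₁ y₂) (hint y₂ v)]
    have hδB : δ ≤ B := by
      have : (1 : ℝ) ≤ 4 ^ k := one_le_pow₀ (by norm_num)
      have h0 : 0 ≤ 4 / (Λ * (c * δ ^ (k + 1)) ^ 2) := by positivity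
      calc δ ≤ δ + 4 / (Λ * (c * δ ^ (k + 1)) ^ 2) := by linarith
        _ ≤ _ := le_mul_of_one_le_left (by positivity) this
    calc _ ≤ B + (2 * δ + B) := (norm_add_le _ _).trans (add_le_add hleft
          ((norm_add_le _ _).trans (add_le_add hmid hright)))
      _ ≤ 4 * B := by linarith
      _ = _ := by rw [hB, pow_succ]; ring

/-- Insertion of an amplitude into an oscillatory integral. -/
theorem norm_integral_mul_le_of_primitive {E ψ : ℝ → ℂ} (hE : Continuous E) (hψ : ContDiff ℝ 1 ψ)
    {u v B M : ℝ} (huv : u ≤ v) (hlen : v - u ≤ 2) (hv : ψ v = 0) (hM : ∀ s, ‖deriv ψ s‖ ≤ M)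
    (hM0 : 0 ≤ M) (hB : ∀ w ∈ Icc u v, ‖∫ s in u..w, E s‖ ≤ B) :
    ‖∫ s in u..v, ψ s * E s‖ ≤ 2 * M * B := by
  have hderψ : ∀ s, HasDerivAt ψ (deriv ψ s) s := fun s =>
    (hψ.differentiable one_ne_zero s).hasDerivAt
  have hcψ : Continuous (deriv ψ) := hψ.continuous_deriv le_rfl
  have hG : ∀ s, HasDerivAt (fun w => ∫ s in u..w, E s) (E s) s := fun s =>
    intervalIntegral.integral_hasDerivAt_right (hE.intervalIntegrable _ _)
      (hE.stronglyMeasurableAtFilter _ _) hE.continuousAt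
  -- The primitive of E vanishes at u and ψ vanishes at v, so no boundary term survives.
  rw [intervalIntegral.integral_mul_deriv_eq_deriv_mul (u := ψ) (v := fun w => ∫ s in u..w, E s)
    (fun s _ => hderψ s) (fun s _ => hG s) (hcψ.intervalIntegrable _ _)
    (hE.intervalIntegrable _ _), hv]
  have hB0 : 0 ≤ B := (norm_nonneg _).trans (hB u ⟨le_rfl, huv⟩)
  simp only [zero_mul, intervalIntegral.integral_same, mul_zero, sub_zero, zero_sub, norm_neg]
  calc _ ≤ (M * B) * |v - u| := by
        refine intervalIntegral.norm_integral_le_of_norm_le_const fun s hs => ?_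
        rw [uIoc_of_le huv] at hs
        rw [norm_mul]
        exact mul_le_mul (hM s) (hB s ⟨hs.1.le, hs.2⟩) (norm_nonneg _) hM0
    _ ≤ (M * B) * 2 := by
        rw [abs_of_nonneg (by linarith)]
        gcongr
    _ = _ := by ring

end TransInv

/-! ### Rescaled oscillatory integrals and the gain from cancellation. -/

namespace TransInv

open Set

/-- The polynomial function `∑ c_e s^{e₁} t^{e₂}`, the sum being over `e ∈ S`. -/
noncomputable def monoSum (S : Finset (ℕ × ℕ)) (c : ℕ × ℕ → ℝ) (s t : ℝ) : ℝ :=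
  ∑ e ∈ S, c e * (s ^ e.1 * t ^ e.2)

theorem monoSum_swap (S : Finset (ℕ × ℕ)) (c : ℕ × ℕ → ℝ) (s t : ℝ) :
    monoSum (S.image Prod.swap) (c ∘ Prod.swap) t s = monoSum S c s t := by
  unfold monoSum
  rw [Finset.sum_image (Prod.swap_injective.injOn)]
  simp [mul_comm]

/-- `C¹` amplitudes of size `M` supported in the square of side `2r`. -/
structure IsAmplitude (r M : ℝ) (ψ : ℝ × ℝ → ℂ) : Prop where
  contDiff : ContDiff ℝ 1 ψ
  supp : ∀ z, ψ z ≠ 0 → |z.1| ≤ r ∧ |z.2| ≤ r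
  bound : ∀ z, ‖ψ z‖ ≤ M
  bound_fderiv : ∀ z, ‖fderiv ℝ ψ z‖ ≤ M

theorem hasCompactSupport_of_square {E : Type*} [Zero E] {f : ℝ × ℝ → E} {r : ℝ}
    (hf : ∀ z, f z ≠ 0 → |z.1| ≤ r ∧ |z.2| ≤ r) : HasCompactSupport f :=
  HasCompactSupport.of_support_subset_isCompact (isCompact_Icc (a := -r).prod (isCompact_Icc (b := r)))
    fun z hz => ⟨abs_le.1 (hf z hz).1, abs_le.1 (hf z hz).2⟩

theorem norm_integral_le_of_square {f : ℝ × ℝ → ℂ} {r B : ℝ} (hr : r ≤ 1)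
    (hf : ∀ z, f z ≠ 0 → |z.1| ≤ r ∧ |z.2| ≤ r) (hB : ∀ z, ‖f z‖ ≤ B) :
    ‖∫ z, f z‖ ≤ 4 * B := by
  rw [← setIntegral_eq_integral_of_forall_compl_eq_zero (s := Icc (-1 : ℝ) 1 ×ˢ Icc (-1 : ℝ) 1)]
  · have hvol : (volume : Measure (ℝ × ℝ)) (Icc (-1 : ℝ) 1 ×ˢ Icc (-1 : ℝ) 1) = 4 := by
      rw [Measure.volume_eq_prod, Measure.prod_prod]
      simp only [Real.volume_Icc]
      rw [← ENNReal.ofReal_mul (by norm_num)]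
      norm_num
    refine (norm_setIntegral_le_of_norm_le_const (by rw [hvol]; norm_num)
      fun z _ => hB z).trans_eq ?_
    rw [measureReal_def, hvol]
    norm_num [mul_comm]
  · intro z hz
    by_contra h
    obtain ⟨h1, h2⟩ := hf z h
    exact hz ⟨abs_le.1 (h1.trans hr), abs_le.1 (h2.trans hr)⟩

namespace IsAmplitude

variable {r M : ℝ} {ψ : ℝ × ℝ → ℂ}

theorem nonneg (h : IsAmplitude r M ψ) : 0 ≤ M := (norm_nonneg _).trans (h.bound 0)

theorem continuous (h : IsAmplitude r M ψ) : Continuous ψ := h.contDiff.continuous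

theorem integrable_mul (h : IsAmplitude r M ψ) {g : ℝ × ℝ → ℂ} (hg : Continuous g) :
    Integrable fun z => ψ z * g z :=
  (h.continuous.mul hg).integrable_of_hasCompactSupport
    (hasCompactSupport_of_square h.supp).mul_right

theorem swap (h : IsAmplitude r M ψ) : IsAmplitude r M (ψ ∘ Prod.swap) where
  contDiff := h.contDiff.comp (contDiff_snd.prodMk contDiff_fst)
  supp z hz := (h.supp z.swap hz).symm
  bound z := h.bound _
  bound_fderiv z := by
    have : HasFDerivAt (ψ ∘ Prod.swap) ((fderiv ℝ ψ z.swap).comp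
        ((ContinuousLinearMap.snd ℝ ℝ ℝ).prod (ContinuousLinearMap.fst ℝ ℝ ℝ))) z :=
      ((h.contDiff.differentiable one_ne_zero _).hasFDerivAt).comp z
        (hasFDerivAt_snd.prodMk hasFDerivAt_fst)
    rw [this.fderiv]
    refine (ContinuousLinearMap.opNorm_comp_le _ _).trans ?_
    refine (mul_le_of_le_one_right (norm_nonneg _) ?_).trans (h.bound_fderiv _)
    refine ContinuousLinearMap.opNorm_le_bound _ zero_le_one fun w => ?_
    rw [one_mul, ContinuousLinearMap.prod_apply, Prod.norm_def, Prod.norm_def, max_comm]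
    rfl

end IsAmplitude

/-- The oscillatory integral with phase `ξ p(δ₁ s, δ₂ t)` and amplitude `ψ`. -/
noncomputable def osc (S : Finset (ℕ × ℕ)) (c : ℕ × ℕ → ℝ) (δ₁ δ₂ ξ : ℝ) (ψ : ℝ × ℝ → ℂ) : ℂ :=
  ∫ z : ℝ × ℝ, ψ z * Complex.exp (Complex.I * (ξ * monoSum S c (δ₁ * z.1) (δ₂ * z.2) : ℝ))

/-- Used to deduce each estimate in the second variable from the one in the first. -/
theorem osc_swap (S : Finset (ℕ × ℕ)) (c : ℕ × ℕ → ℝ) (δ₁ δ₂ ξ : ℝ) (ψ : ℝ × ℝ → ℂ) :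
    osc (S.image Prod.swap) (c ∘ Prod.swap) δ₂ δ₁ ξ (ψ ∘ Prod.swap) = osc S c δ₁ δ₂ ξ ψ := by
  unfold osc
  rw [Measure.volume_eq_prod, ← integral_prod_swap]
  simp [monoSum_swap]

theorem norm_osc_le (S : Finset (ℕ × ℕ)) (c : ℕ × ℕ → ℝ) (δ₁ δ₂ ξ : ℝ) {ψ : ℝ × ℝ → ℂ}
    {r M : ℝ} (hr : r ≤ 1) (h : IsAmplitude r M ψ) : ‖osc S c δ₁ δ₂ ξ ψ‖ ≤ 4 * M := by
  refine norm_integral_le_of_square hr (fun z hz => h.supp z (left_ne_zero_of_mul hz)) fun z => ?_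
  rw [norm_mul, Complex.norm_exp_I_mul_ofReal, mul_one]
  exact h.bound z

theorem norm_exp_sub_exp_le (x y : ℝ) :
    ‖Complex.exp (Complex.I * x) - Complex.exp (Complex.I * y)‖ ≤ |x - y| := by
  have : Complex.exp (Complex.I * x) - Complex.exp (Complex.I * y)
      = Complex.exp (Complex.I * y) * (Complex.exp (Complex.I * (x - y : ℝ)) - 1) := by
    rw [mul_sub, ← Complex.exp_add]
    push_cast
    ring_nf
  rw [this, norm_mul, Complex.norm_exp_I_mul_ofReal, one_mul]
  exact Real.norm_exp_I_mul_ofReal_sub_one_le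

/-- A monomial on or above the line, when the first variable dominates. -/
theorem monomial_le_of_le {a b : ℕ} (hb : 0 < b) {e : ℕ × ℕ} (he : a * b ≤ b * e.1 + a * e.2)
    {δ₁ δ₂ : ℝ} (h1 : 0 ≤ δ₁) (h1' : δ₁ ≤ 1) (h2 : 0 ≤ δ₂) (h : δ₂ ^ b ≤ δ₁ ^ a) :
    δ₁ ^ e.1 * δ₂ ^ e.2 ≤ δ₁ ^ a := by
  -- After taking b-th powers, the position of e relative to the line becomes a comparison of
  -- integer exponents of δ₁.
  rw [← pow_le_pow_iff_left₀ (by positivity) (by positivity) hb.ne']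
  calc (δ₁ ^ e.1 * δ₂ ^ e.2) ^ b = δ₁ ^ (b * e.1) * (δ₂ ^ b) ^ e.2 := by
        rw [mul_pow, ← pow_mul, ← pow_mul, ← pow_mul, mul_comm e.1, mul_comm e.2]
    _ ≤ δ₁ ^ (b * e.1) * (δ₁ ^ a) ^ e.2 := by gcongr
    _ = δ₁ ^ (b * e.1 + a * e.2) := by rw [← pow_mul, pow_add]
    _ ≤ δ₁ ^ (a * b) := pow_le_pow_of_le_one h1 h1' he
    _ = (δ₁ ^ a) ^ b := by rw [pow_mul]

/-- A monomial on or above the line which vanishes with the first variable. -/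
theorem monomial_le_rpow {a b : ℕ} (ha : 0 < a) (hb : 0 < b) {e : ℕ × ℕ}
    (he : a * b ≤ b * e.1 + a * e.2) (he1 : e.1 ≠ 0)
    {δ₁ δ₂ ξ : ℝ} (h1 : 0 ≤ δ₁) (h1' : δ₁ ≤ 1) (h2 : 0 ≤ δ₂) (h2' : δ₂ ≤ 1) (hξ : 0 ≤ ξ)
    (hX : ξ * δ₁ ^ a ≤ 1) :
    ξ * (δ₁ ^ e.1 * δ₂ ^ e.2) ≤ (ξ * δ₁ ^ a) ^ (((a * b : ℕ) : ℝ)⁻¹) * (1 + ξ * δ₂ ^ b) := by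
  have hn : 0 < a * b := Nat.mul_pos ha hb
  rcases le_total (δ₂ ^ b) (δ₁ ^ a) with h | h
  · calc ξ * (δ₁ ^ e.1 * δ₂ ^ e.2) ≤ ξ * δ₁ ^ a := by
          gcongr; exact monomial_le_of_le hb he h1 h1' h2 h
      _ = (ξ * δ₁ ^ a) ^ (1 : ℝ) := by rw [Real.rpow_one]
      _ ≤ (ξ * δ₁ ^ a) ^ (((a * b : ℕ) : ℝ)⁻¹) := by
          refine Real.rpow_le_rpow_of_exponent_ge' (by positivity) hX (by positivity) ?_
          exact inv_le_one_of_one_le₀ (by exact_mod_cast hn)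
      _ ≤ _ := le_mul_of_one_le_right (by positivity) (by
          have : 0 ≤ ξ * δ₂ ^ b := by positivity
          linarith)
  -- Now A = δ₁^a ≤ B = δ₂^b. In the (ab)-th power one factor A is kept, which is possible since e.1
  -- ≠ 0; the others are replaced by B, and surplus powers of B ≤ 1 are dropped. This leaves
  -- (ξA)(ξB)^(ab-1).
  · rw [← pow_le_pow_iff_left₀ (by positivity) (by positivity) hn.ne', mul_pow _ (1 + _),
      Real.rpow_inv_natCast_pow (by positivity) hn.ne']
    set A := δ₁ ^ a with hA
    set B := δ₂ ^ b with hB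
    have hA0 : 0 ≤ A := by positivity
    have hB0 : 0 ≤ B := by positivity
    have hB1 : B ≤ 1 := pow_le_one₀ h2 h2'
    obtain ⟨m, hm⟩ : ∃ m, a * b = m + 1 := ⟨a * b - 1, by omega⟩
    obtain ⟨l, hl⟩ : ∃ l, b * e.1 = l + 1 :=
      ⟨b * e.1 - 1, by have := Nat.mul_pos hb (Nat.pos_of_ne_zero he1); omega⟩
    have hY : 0 ≤ ξ * B := by positivity
    calc (ξ * (δ₁ ^ e.1 * δ₂ ^ e.2)) ^ (a * b)
        = ξ ^ (a * b) * (A ^ (b * e.1) * B ^ (a * e.2)) := by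
          rw [mul_pow, mul_pow, hA, hB, ← pow_mul, ← pow_mul, ← pow_mul, ← pow_mul]
          congr 3 <;> ring
      _ = ξ ^ (m + 1) * (A ^ l * A * B ^ (a * e.2)) := by rw [hl, hm, pow_succ A]
      _ ≤ ξ ^ (m + 1) * (B ^ l * A * B ^ (a * e.2)) := by gcongr
      _ = ξ ^ (m + 1) * (A * B ^ (l + a * e.2)) := by ring
      _ ≤ ξ ^ (m + 1) * (A * B ^ m) := by
          have := pow_le_pow_of_le_one hB0 hB1 (show m ≤ l + a * e.2 by omega)
          gcongr
      _ = ξ * A * (ξ * B) ^ m := by ring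
      _ ≤ ξ * A * (1 + ξ * B) ^ m := by gcongr; linarith
      _ ≤ ξ * A * (1 + ξ * B) ^ (a * b) := by
          rw [hm]
          gcongr
          · linarith
          · omega

/-- The gain from cancellation in the first variable. -/
theorem norm_osc_le_of_cancel {S : Finset (ℕ × ℕ)} {a b : ℕ} (ha : 0 < a) (hb : 0 < b)
    (hS : ∀ e ∈ S, a * b ≤ b * e.1 + a * e.2) (c : ℕ × ℕ → ℝ)
    {δ₁ δ₂ ξ : ℝ} (h1 : 0 ≤ δ₁) (h1' : δ₁ ≤ 1) (h2 : 0 ≤ δ₂) (h2' : δ₂ ≤ 1)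
    (hX : |ξ| * δ₁ ^ a ≤ 1) {ψ : ℝ × ℝ → ℂ} {r M : ℝ} (hr : r ≤ 1) (h : IsAmplitude r M ψ)
    (hc : ∀ t, ∫ s, ψ (s, t) = 0) :
    ‖osc S c δ₁ δ₂ ξ ψ‖ ≤ 4 * (M * ((∑ e ∈ S, |c e|) *
      ((|ξ| * δ₁ ^ a) ^ (((a * b : ℕ) : ℝ)⁻¹) * (1 + |ξ| * δ₂ ^ b)))) := by
  set W := (|ξ| * δ₁ ^ a) ^ (((a * b : ℕ) : ℝ)⁻¹) * (1 + |ξ| * δ₂ ^ b) with hW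
  have hW0 : 0 ≤ W := by positivity
  have hcont : Continuous fun z : ℝ × ℝ =>
      Complex.exp (Complex.I * (ξ * monoSum S c (δ₁ * z.1) (δ₂ * z.2) : ℝ)) := by
    unfold monoSum; fun_prop
  have hcont0 : Continuous fun z : ℝ × ℝ =>
      Complex.exp (Complex.I * (ξ * monoSum S c (δ₁ * 0) (δ₂ * z.2) : ℝ)) := by
    unfold monoSum; fun_prop
  -- At s = 0 the phase depends on t alone, so its exponential integrates to zero against ψ and may
  -- be subtracted. In the difference of phases only monomials with e.1 ≠ 0 remain.
  have hzero : ∫ z : ℝ × ℝ, ψ z *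
      Complex.exp (Complex.I * (ξ * monoSum S c (δ₁ * 0) (δ₂ * z.2) : ℝ)) = 0 := by
    have := h.integrable_mul hcont0
    rw [Measure.volume_eq_prod] at this ⊢
    rw [integral_prod_symm _ this]
    simp only [integral_mul_const, hc, zero_mul, integral_zero]
  have heq : osc S c δ₁ δ₂ ξ ψ = ∫ z : ℝ × ℝ, ψ z *
      (Complex.exp (Complex.I * (ξ * monoSum S c (δ₁ * z.1) (δ₂ * z.2) : ℝ)) -
        Complex.exp (Complex.I * (ξ * monoSum S c (δ₁ * 0) (δ₂ * z.2) : ℝ))) := by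
    simp only [mul_sub]
    rw [integral_sub (h.integrable_mul hcont) (h.integrable_mul hcont0), hzero, sub_zero]
    rfl
  rw [heq]
  refine norm_integral_le_of_square hr (fun z hz => h.supp z (left_ne_zero_of_mul hz)) fun z => ?_
  by_cases hz : ψ z = 0
  · rw [hz, zero_mul, norm_zero]
    have := h.nonneg
    have : 0 ≤ ∑ e ∈ S, |c e| := Finset.sum_nonneg fun _ _ => abs_nonneg _
    positivity
  obtain ⟨hz1, hz2⟩ := h.supp z hz
  replace hz1 := hz1.trans hr
  replace hz2 := hz2.trans hr
  rw [norm_mul]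
  refine mul_le_mul (h.bound z) ((norm_exp_sub_exp_le _ _).trans ?_) (norm_nonneg _) h.nonneg
  rw [← mul_sub, abs_mul, monoSum, monoSum, ← Finset.sum_sub_distrib, Finset.sum_mul]
  refine (mul_le_mul_of_nonneg_left (Finset.abs_sum_le_sum_abs _ _) (abs_nonneg _)).trans ?_
  rw [Finset.mul_sum]
  refine Finset.sum_le_sum fun e he => ?_
  rw [← mul_sub, ← sub_mul, abs_mul, mul_left_comm]
  refine mul_le_mul_of_nonneg_left ?_ (abs_nonneg _)
  by_cases he1 : e.1 = 0
  · simpa [he1] using hW0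
  · rw [mul_zero, zero_pow he1, sub_zero]
    refine le_trans ?_ (monomial_le_rpow ha hb (hS e he) he1 h1 h1' h2 h2' (abs_nonneg ξ) hX)
    rw [abs_mul, abs_pow, abs_pow, abs_mul, abs_mul, abs_of_nonneg h1, abs_of_nonneg h2]
    have : δ₁ * |z.1| ≤ δ₁ := mul_le_of_le_one_right h1 hz1
    have : δ₂ * |z.2| ≤ δ₂ := mul_le_of_le_one_right h2 hz2
    gcongr

end TransInv

/-! ### Decay from the dominant pure power. -/

namespace TransInv

open Polynomial Set

/-- The phase `ξ p(δ₁ s, δ₂ t)` as a polynomial in `s`. -/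
noncomputable def slicePoly (S : Finset (ℕ × ℕ)) (c : ℕ × ℕ → ℝ) (δ₁ δ₂ ξ t : ℝ) : ℝ[X] :=
  ∑ e ∈ S, C (c e * (ξ * (δ₁ ^ e.1 * (δ₂ * t) ^ e.2))) * X ^ e.1

theorem eval_slicePoly (S : Finset (ℕ × ℕ)) (c : ℕ × ℕ → ℝ) (δ₁ δ₂ ξ t s : ℝ) :
    (slicePoly S c δ₁ δ₂ ξ t).eval s = ξ * monoSum S c (δ₁ * s) (δ₂ * t) := by
  simp only [slicePoly, monoSum, eval_finsetSum, Finset.mul_sum, eval_mul, eval_C, eval_pow,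
    eval_X]
  refine Finset.sum_congr rfl fun e _ => ?_
  ring

theorem eval_iterate_derivative_slicePoly (S : Finset (ℕ × ℕ)) (c : ℕ × ℕ → ℝ)
    (δ₁ δ₂ ξ t s : ℝ) (k : ℕ) :
    (derivative^[k] (slicePoly S c δ₁ δ₂ ξ t)).eval s =
      ∑ e ∈ S, c e * (e.1.descFactorial k) *
        (ξ * (δ₁ ^ e.1 * (δ₂ * t) ^ e.2)) * s ^ (e.1 - k) := by
  simp only [slicePoly, iterate_derivative_sum, iterate_derivative_C_mul,
    iterate_derivative_X_pow_eq_natCast_mul, eval_finsetSum, eval_mul, eval_C, eval_pow,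
    eval_X, eval_natCast]
  refine Finset.sum_congr rfl fun e _ => ?_
  ring

/-- With X = |ξ| δ₁^a, dominance of the first variable makes every coefficient of the phase O(X). In
the a-th s-derivative, (a, 0) contributes a constant of size comparable to X. Monomials with e.1 < a
disappear, and every other one carries a factor s or t, hence is small near the origin. Van der
Corput applies with upper bound on the second derivative and lower bound on the a-th, both multiples
of X. -/
theorem exists_norm_integral_slice_le {S : Finset (ℕ × ℕ)} {a b : ℕ} (ha : 0 < a) (hb : 0 < b)
    (hS : ∀ e ∈ S, a * b ≤ b * e.1 + a * e.2) (c : ℕ × ℕ → ℝ) (haS : (a, 0) ∈ S)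
    (hca : c (a, 0) ≠ 0) :
    ∃ r₀ : ℝ, 0 < r₀ ∧ r₀ ≤ 1 ∧ ∃ K : ℝ, 0 ≤ K ∧ ∀ δ₁ δ₂ ξ t : ℝ, 0 ≤ δ₁ → δ₁ ≤ 1 → 0 ≤ δ₂ →
      δ₂ ≤ 1 → δ₂ ^ b ≤ δ₁ ^ a → 1 ≤ |ξ| * δ₁ ^ a → |t| ≤ r₀ → ∀ w ∈ Icc (-r₀) r₀,
      ‖∫ s in (-r₀)..w, Complex.exp (Complex.I * (ξ * monoSum S c (δ₁ * s) (δ₂ * t) : ℝ))‖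
        ≤ K * (|ξ| * δ₁ ^ a) ^ (-((2 * a : ℕ) : ℝ)⁻¹) := by
  set D₂ : ℝ := ∑ e ∈ S, |c e| * (e.1.descFactorial 2) with hD₂
  set Da : ℝ := ∑ e ∈ S, |c e| * (e.1.descFactorial a) with hDa
  set A : ℝ := |c (a, 0)| * (a.descFactorial a) with hA
  have hA0 : 0 < A := mul_pos (abs_pos.2 hca) (by
    exact_mod_cast Nat.pos_of_ne_zero (by simp [Nat.descFactorial_self, Nat.factorial_ne_zero]))
  have hD₂0 : 0 ≤ D₂ := Finset.sum_nonneg fun _ _ => by positivity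
  have hDa0 : 0 ≤ Da := Finset.sum_nonneg fun _ _ => by positivity
  -- Chosen so that r₀ Da ≤ A / 2: the remaining terms of the a-th derivative are at most half the
  -- main one.
  set r₀ : ℝ := min 1 (A / (2 * (1 + Da))) with hr₀
  have hr0 : 0 < r₀ := lt_min one_pos (by positivity)
  have hr1 : r₀ ≤ 1 := min_le_left _ _
  have hrA : r₀ * Da ≤ A / 2 := by
    calc r₀ * Da ≤ A / (2 * (1 + Da)) * (1 + Da) := by
          gcongr
          · exact min_le_right _ _
          · linarith
      _ = A / 2 := by field_simp
  set D : ℝ := D₂ + A with hD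
  have hD0 : 0 < D := by linarith
  set γ : ℝ := A / 2 / D with hγ
  have hγ0 : 0 < γ := by positivity
  have hγ1 : γ ≤ 1 := by rw [hγ, div_le_one hD0]; linarith
  obtain ⟨k, rfl⟩ : ∃ k, a = k + 1 := ⟨a - 1, by omega⟩
  refine ⟨r₀, hr0, hr1, 4 ^ k * (1 + 4 / (D * γ ^ 2)), by positivity, ?_⟩
  intro δ₁ δ₂ ξ t h1 h1' h2 h2' h12 hX ht w hw
  set X := |ξ| * δ₁ ^ (k + 1) with hXdef
  have hX0 : 0 < X := by linarith
  -- With X δ^(2(k+1)) = 1 the second term 1 / (X δ^(2k)) of van der Corput's bound is δ², which is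
  -- at most δ.
  set δ : ℝ := X ^ (-((2 * (k + 1) : ℕ) : ℝ)⁻¹) with hδ
  have hδ0 : 0 < δ := Real.rpow_pos_of_pos hX0 _
  have hδ1 : δ ≤ 1 := Real.rpow_le_one_of_one_le_of_nonpos hX (by simp; positivity)
  have hδX : X * δ ^ (2 * (k + 1)) = 1 := by
    rw [hδ, Real.rpow_neg hX0.le, inv_pow, Real.rpow_inv_natCast_pow hX0.le (by positivity)]
    exact mul_inv_cancel₀ hX0.ne'
  have hmono : ∀ e ∈ S, |ξ| * (δ₁ ^ e.1 * (δ₂ * |t|) ^ e.2) ≤ X * |t| ^ e.2 := by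
    intro e he
    have := monomial_le_of_le hb (hS e he) h1 h1' h2 h12
    calc |ξ| * (δ₁ ^ e.1 * (δ₂ * |t|) ^ e.2) = |ξ| * (δ₁ ^ e.1 * δ₂ ^ e.2) * |t| ^ e.2 := by
          rw [mul_pow]; ring
      _ ≤ |ξ| * δ₁ ^ (k + 1) * |t| ^ e.2 := by gcongr
  have ht1 : |t| ≤ 1 := ht.trans hr1
  have habs : ∀ (e : ℕ × ℕ) (m : ℕ) (s : ℝ), |c e * (e.1.descFactorial m) *
        (ξ * (δ₁ ^ e.1 * (δ₂ * t) ^ e.2)) * s ^ (e.1 - m)| = |c e| * (e.1.descFactorial m) *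
        (|ξ| * (δ₁ ^ e.1 * (δ₂ * |t|) ^ e.2)) * |s| ^ (e.1 - m) := by
    intro e m s
    simp only [abs_mul, abs_pow, abs_of_nonneg h1, abs_of_nonneg h2, Nat.abs_cast]
  have hsecond : ∀ s ∈ Icc (-r₀) w,
      |(derivative (derivative (slicePoly S c δ₁ δ₂ ξ t))).eval s| ≤ D * X := by
    intro s hs
    have hs1 : |s| ≤ 1 := (abs_le.2 ⟨hs.1, hs.2.trans hw.2⟩).trans hr1
    have := eval_iterate_derivative_slicePoly S c δ₁ δ₂ ξ t s 2
    simp only [Function.iterate_succ, Function.iterate_zero, Function.comp_apply, id] at this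
    rw [this]
    refine (Finset.abs_sum_le_sum_abs _ _).trans ?_
    calc _ ≤ ∑ e ∈ S, |c e| * (e.1.descFactorial 2) * X := by
          refine Finset.sum_le_sum fun e he => ?_
          rw [habs, mul_assoc]
          refine mul_le_mul_of_nonneg_left ?_ (by positivity)
          calc _ ≤ X * |t| ^ e.2 * 1 := by
                exact mul_le_mul (hmono e he) (pow_le_one₀ (abs_nonneg _) hs1) (by positivity)
                  (by positivity)
            _ ≤ X * 1 * 1 := by
                gcongr
                exact pow_le_one₀ (abs_nonneg _) ht1
            _ = X := by ring
      _ = D₂ * X := by rw [hD₂, Finset.sum_mul]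
      _ ≤ D * X := by gcongr; linarith
  have hlower : ∀ s ∈ Icc (-r₀) w,
      γ * (D * X) ≤ |(derivative^[k + 1] (slicePoly S c δ₁ δ₂ ξ t)).eval s| := by
    intro s hs
    have hs1 : |s| ≤ r₀ := abs_le.2 ⟨hs.1, hs.2.trans hw.2⟩
    rw [eval_iterate_derivative_slicePoly, ← Finset.add_sum_erase _ _ haS]
    have hrest : |∑ e ∈ S.erase (k + 1, 0), c e * (e.1.descFactorial (k + 1)) *
        (ξ * (δ₁ ^ e.1 * (δ₂ * t) ^ e.2)) * s ^ (e.1 - (k + 1))| ≤ r₀ * Da * X := by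
      refine (Finset.abs_sum_le_sum_abs _ _).trans ?_
      calc _ ≤ ∑ e ∈ S.erase (k + 1, 0), |c e| * (e.1.descFactorial (k + 1)) * (X * r₀) := by
            refine Finset.sum_le_sum fun e he => ?_
            obtain ⟨hne, he⟩ := Finset.mem_erase.1 he
            rw [habs]
            by_cases hlt : e.1 < k + 1
            · rw [Nat.descFactorial_eq_zero_iff_lt.2 hlt]
              simp
            rw [mul_assoc]
            refine mul_le_mul_of_nonneg_left ?_ (by positivity)
            calc _ ≤ X * |t| ^ e.2 * |s| ^ (e.1 - (k + 1)) := by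
                  exact mul_le_mul_of_nonneg_right (hmono e he) (by positivity)
              _ ≤ X * r₀ ^ e.2 * r₀ ^ (e.1 - (k + 1)) := by gcongr
              _ = X * r₀ ^ (e.2 + (e.1 - (k + 1))) := by rw [pow_add]; ring
              _ ≤ X * r₀ := by
                  gcongr
                  refine pow_le_of_le_one hr0.le hr1 fun h0 => hne ?_
                  ext <;> simp <;> omega
        _ ≤ ∑ e ∈ S, |c e| * (e.1.descFactorial (k + 1)) * (X * r₀) :=
            Finset.sum_le_sum_of_subset_of_nonneg (Finset.erase_subset _ _)
              fun _ _ _ => by positivity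
        _ = r₀ * Da * X := by rw [← Finset.sum_mul]; ring
    have hmain : |c (k + 1, 0) * ((k + 1 : ℕ).descFactorial (k + 1)) *
        (ξ * (δ₁ ^ (k + 1) * (δ₂ * t) ^ 0)) * s ^ ((k + 1) - (k + 1))| = A * X := by
      rw [pow_zero, mul_one, Nat.sub_self, pow_zero, mul_one, abs_mul, abs_mul, abs_mul, abs_pow,
        abs_of_nonneg h1, Nat.abs_cast]
    have hγD : γ * (D * X) = A / 2 * X := by rw [hγ]; field_simp
    have htri := abs_sub_abs_le_abs_add (c (k + 1, 0) * ((k + 1 : ℕ).descFactorial (k + 1)) *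
        (ξ * (δ₁ ^ (k + 1) * (δ₂ * t) ^ 0)) * s ^ ((k + 1) - (k + 1)))
        (∑ e ∈ S.erase (k + 1, 0), c e * (e.1.descFactorial (k + 1)) *
        (ξ * (δ₁ ^ e.1 * (δ₂ * t) ^ e.2)) * s ^ (e.1 - (k + 1)))
    rw [hmain] at htri
    refine le_trans ?_ htri
    rw [hγD]
    have : r₀ * Da * X ≤ A / 2 * X := by gcongr
    linarith
  have hvdc := norm_integral_exp_le k (slicePoly S c δ₁ δ₂ ξ t) (Λ := D * X) (by positivity)
    hδ0 hδ1 hγ0 hγ1 hw.1 (by linarith [hw.2]) hsecond hlower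
  simp only [eval_slicePoly] at hvdc
  refine hvdc.trans ?_
  rw [mul_assoc ((4 : ℝ) ^ k)]
  refine mul_le_mul_of_nonneg_left ?_ (by positivity)
  have hXd : D * X * (γ * δ ^ k) ^ 2 * δ ^ 2 = D * γ ^ 2 := by
    calc _ = D * γ ^ 2 * (X * δ ^ (2 * (k + 1))) := by ring
      _ = _ := by rw [hδX, mul_one]
  have : 4 / (D * X * (γ * δ ^ k) ^ 2) = 4 / (D * γ ^ 2) * δ ^ 2 := by
    rw [← hXd]; field_simp
  rw [this, one_add_mul (4 / (D * γ ^ 2)) δ]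
  gcongr
  exact pow_le_of_le_one hδ0.le hδ1 (by norm_num)

/-- Decay of the oscillatory integral when the first variable dominates. -/
theorem exists_norm_osc_le_decay {S : Finset (ℕ × ℕ)} {a b : ℕ} (ha : 0 < a) (hb : 0 < b)
    (hS : ∀ e ∈ S, a * b ≤ b * e.1 + a * e.2) (c : ℕ × ℕ → ℝ) (haS : (a, 0) ∈ S)
    (hca : c (a, 0) ≠ 0) :
    ∃ r₀ : ℝ, 0 < r₀ ∧ r₀ ≤ 1 ∧ ∃ K : ℝ, 0 ≤ K ∧ ∀ δ₁ δ₂ ξ : ℝ, 0 ≤ δ₁ → δ₁ ≤ 1 → 0 ≤ δ₂ →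
      δ₂ ≤ 1 → δ₂ ^ b ≤ δ₁ ^ a → 1 ≤ |ξ| * δ₁ ^ a → ∀ (r M : ℝ) (ψ : ℝ × ℝ → ℂ), r < r₀ →
      IsAmplitude r M ψ →
      ‖osc S c δ₁ δ₂ ξ ψ‖ ≤ K * M * (|ξ| * δ₁ ^ a) ^ (-((2 * a : ℕ) : ℝ)⁻¹) := by
  obtain ⟨r₀, hr0, hr1, K, hK, hmain⟩ := exists_norm_integral_slice_le ha hb hS c haS hca
  refine ⟨r₀, hr0, hr1, 4 * K, by positivity, ?_⟩
  intro δ₁ δ₂ ξ h1 h1' h2 h2' h12 hX r M ψ hr hψ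
  set B := K * (|ξ| * δ₁ ^ a) ^ (-((2 * a : ℕ) : ℝ)⁻¹) with hB
  have hB0 : 0 ≤ B := by positivity
  have hM := hψ.nonneg
  have hcont : Continuous fun z : ℝ × ℝ =>
      Complex.exp (Complex.I * (ξ * monoSum S c (δ₁ * z.1) (δ₂ * z.2) : ℝ)) := by
    unfold monoSum; fun_prop
  have hinner : ∀ t : ℝ, ‖∫ s : ℝ, ψ (s, t) *
      Complex.exp (Complex.I * (ξ * monoSum S c (δ₁ * s) (δ₂ * t) : ℝ))‖ ≤ 2 * M * B := by
    intro t
    by_cases ht : |t| ≤ r₀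
    · have hslice : ContDiff ℝ 1 fun s : ℝ => ψ (s, t) :=
        hψ.contDiff.comp (contDiff_id.prodMk contDiff_const)
      have hderiv : ∀ s, ‖deriv (fun s : ℝ => ψ (s, t)) s‖ ≤ M := by
        intro s
        have hl : HasDerivAt (fun s : ℝ => ((s, t) : ℝ × ℝ)) (1, 0) s :=
          (hasDerivAt_id' s).prodMk (hasDerivAt_const s t)
        have hd : HasDerivAt (fun s : ℝ => ψ (s, t)) (fderiv ℝ ψ (s, t) (1, 0)) s :=
          (hψ.contDiff.differentiable one_ne_zero (s, t)).hasFDerivAt.comp_hasDerivAt s hl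
        rw [hd.deriv]
        refine ((fderiv ℝ ψ (s, t)).le_opNorm _).trans ?_
        rw [Prod.norm_def]
        simpa using hψ.bound_fderiv (s, t)
      have hEc : Continuous fun s : ℝ =>
          Complex.exp (Complex.I * (ξ * monoSum S c (δ₁ * s) (δ₂ * t) : ℝ)) := by
        unfold monoSum; fun_prop
      have := norm_integral_mul_le_of_primitive (E := fun s : ℝ =>
          Complex.exp (Complex.I * (ξ * monoSum S c (δ₁ * s) (δ₂ * t) : ℝ)))
        hEc hslice (u := -r₀) (v := r₀) (B := B) (by linarith) (by linarith)
        (by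
          by_contra h0
          have := (hψ.supp _ h0).1
          simp only [abs_of_pos hr0] at this
          linarith) hderiv hM
        (fun w hw => hmain δ₁ δ₂ ξ t h1 h1' h2 h2' h12 hX ht w hw)
      rw [intervalIntegral.integral_of_le (by linarith),
        setIntegral_eq_integral_of_forall_compl_eq_zero] at this
      · exact this
      · intro s hs
        by_contra h0
        have h3 := (hψ.supp _ (left_ne_zero_of_mul h0)).1
        obtain ⟨h4, h5⟩ := abs_le.1 h3
        simp only at h4 h5
        exact hs ⟨by linarith, by linarith⟩
    · have : ∀ s, ψ (s, t) = 0 := by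
        intro s
        by_contra h0
        exact ht ((hψ.supp _ h0).2.trans hr.le)
      simp only [this, zero_mul, integral_zero, norm_zero]
      positivity
  have hint := hψ.integrable_mul hcont
  unfold osc
  rw [Measure.volume_eq_prod] at hint ⊢
  rw [integral_prod_symm _ hint,
    ← setIntegral_eq_integral_of_forall_compl_eq_zero (s := Icc (-1 : ℝ) 1)]
  · refine (norm_setIntegral_le_of_norm_le_const (by simp) fun t _ => hinner t).trans_eq ?_
    rw [measureReal_def, Real.volume_Icc, ENNReal.toReal_ofReal (by norm_num)]
    linear_combination (4 * M) * hB
  · intro t ht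
    have : ∀ s, ψ (s, t) = 0 := by
      intro s
      by_contra h0
      exact ht (abs_le.1 ((hψ.supp _ h0).2.trans (hr.le.trans hr1)))
    simp only [this, zero_mul, integral_zero]

end TransInv

/-! ### Interpolation of the two estimates and summation over scales. -/

namespace TransInv

open Set

theorem min_inv_of_le_one {x : ℝ} (h0 : 0 ≤ x) (h1 : x ≤ 1) : min x x⁻¹ = x := by
  rcases h0.eq_or_lt with rfl | h0
  · simp
  · exact min_eq_left (h1.trans ((one_le_inv₀ h0).2 h1))

theorem min_inv_of_one_le {x : ℝ} (h1 : 1 ≤ x) : min x x⁻¹ = x⁻¹ :=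
  min_eq_right ((inv_le_one_of_one_le₀ h1).trans h1)

theorem min_inv_nonneg {x : ℝ} (h0 : 0 ≤ x) : 0 ≤ min x x⁻¹ := le_min h0 (inv_nonneg.2 h0)

theorem min_inv_le_one (x : ℝ) : min x x⁻¹ ≤ 1 := by
  rcases le_total x 1 with h | h
  · exact (min_le_left _ _).trans h
  · exact (min_le_right _ _).trans (inv_le_one_of_one_le₀ h)

/-- Interpolation between decay for large parameters and gain from cancellation. -/
theorem le_rpow_of_decay_of_cancel {m C X Y σ θ : ℝ} (hC : 0 ≤ C) (hX : 0 ≤ X) (hσ : 0 < σ)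
    (hσ1 : σ ≤ 1) (hθ : 0 < θ) (hθ1 : θ ≤ 1)
    (hdecay : 1 ≤ max X Y → m ≤ C * (max X Y) ^ (-σ))
    (hcancel : X ≤ 1 → m ≤ C * (X ^ θ * (1 + Y))) :
    m ≤ 2 * C * (min X X⁻¹) ^ (θ * σ / 2) := by
  have hκ : 0 < θ * σ / 2 := by positivity
  have hκσ : θ * σ / 2 ≤ σ := by nlinarith
  have hκθ : θ * σ / 2 ≤ θ / 2 := by nlinarith
  rcases le_total 1 X with h | h
  · rw [min_inv_of_one_le h, Real.inv_rpow hX, ← Real.rpow_neg hX]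
    have hm := hdecay (le_max_of_le_left h)
    have hX0 : 0 < X := by linarith
    calc m ≤ C * (max X Y) ^ (-σ) := hm
      _ ≤ C * X ^ (-σ) := by
          gcongr ?_ * ?_
          exact Real.rpow_le_rpow_of_nonpos hX0 (le_max_left _ _) (by linarith)
      _ ≤ C * X ^ (-(θ * σ / 2)) := by
          gcongr
      _ ≤ _ := by
          have : 0 ≤ C * X ^ (-(θ * σ / 2)) := by positivity
          linarith
  · rw [min_inv_of_le_one hX h]
    have hc := hcancel h
    rcases hX.eq_or_lt with rfl | hX0
    · rw [Real.zero_rpow hθ.ne'] at hc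
      rw [Real.zero_rpow hκ.ne']
      linarith
    rcases le_total Y 1 with hY | hY
    · calc m ≤ C * (X ^ θ * (1 + Y)) := hc
        _ ≤ C * (X ^ θ * 2) := by gcongr; linarith
        _ ≤ C * (X ^ (θ * σ / 2) * 2) := by
            have := Real.rpow_le_rpow_of_exponent_ge hX0 h (show θ * σ / 2 ≤ θ by linarith)
            gcongr
        _ = _ := by ring
    -- Below this threshold cancellation still leaves X^(θ/2); above it, decay in Y gives X^(θσ/2).
    rcases le_total Y (X ^ (-(θ / 2))) with hYX | hYX
    · calc m ≤ C * (X ^ θ * (1 + Y)) := hc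
        _ ≤ C * (X ^ θ * (2 * X ^ (-(θ / 2)))) := by gcongr; linarith
        _ = 2 * C * (X ^ θ * X ^ (-(θ / 2))) := by ring
        _ = 2 * C * X ^ (θ / 2) := by rw [← Real.rpow_add hX0]; congr 2; ring
        _ ≤ 2 * C * X ^ (θ * σ / 2) := by
            have := Real.rpow_le_rpow_of_exponent_ge hX0 h hκθ
            gcongr
    · have hmax : max X Y = Y := max_eq_right (h.trans hY)
      have hm := hdecay (by rw [hmax]; exact hY)
      rw [hmax] at hm
      calc m ≤ C * Y ^ (-σ) := hm
        _ ≤ C * (X ^ (-(θ / 2))) ^ (-σ) := by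
            gcongr ?_ * ?_
            exact Real.rpow_le_rpow_of_nonpos (by positivity) hYX (by linarith)
        _ = C * X ^ (θ * σ / 2) := by rw [← Real.rpow_mul hX]; congr 2; ring
        _ ≤ _ := by
            have : 0 ≤ C * X ^ (θ * σ / 2) := by positivity
            linarith

/-- The hypotheses on the exponents and coefficients: every exponent lies on or above the line
through `(a,0)` and `(0,b)`, and both of these occur. -/
structure IsAdmissible (S : Finset (ℕ × ℕ)) (c : ℕ × ℕ → ℝ) (a b : ℕ) : Prop where
  pos_left : 0 < a
  pos_right : 0 < b
  above : ∀ e ∈ S, a * b ≤ b * e.1 + a * e.2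
  mem_left : (a, 0) ∈ S
  mem_right : (0, b) ∈ S
  ne_left : c (a, 0) ≠ 0
  ne_right : c (0, b) ≠ 0

theorem IsAdmissible.swap {S : Finset (ℕ × ℕ)} {c : ℕ × ℕ → ℝ} {a b : ℕ}
    (h : IsAdmissible S c a b) : IsAdmissible (S.image Prod.swap) (c ∘ Prod.swap) b a where
  pos_left := h.pos_right
  pos_right := h.pos_left
  above e he := by
    obtain ⟨e', he', rfl⟩ := Finset.mem_image.1 he
    have := h.above e' he'
    simp only [Prod.fst_swap, Prod.snd_swap]
    linarith
  mem_left := Finset.mem_image.2 ⟨_, h.mem_right, rfl⟩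
  mem_right := Finset.mem_image.2 ⟨_, h.mem_left, rfl⟩
  ne_left := h.ne_right
  ne_right := h.ne_left

/-- Whichever of δ₁^a and δ₂^b is larger decides the variable to which van der Corput is applied.
The exponent 1/(2ab) is a common weakening of 1/(2a) and 1/(2b). -/
theorem exists_norm_osc_le_max {S : Finset (ℕ × ℕ)} {c : ℕ × ℕ → ℝ} {a b : ℕ}
    (h : IsAdmissible S c a b) :
    ∃ r₀ : ℝ, 0 < r₀ ∧ r₀ ≤ 1 ∧ ∃ K : ℝ, 0 ≤ K ∧ ∀ δ₁ δ₂ ξ : ℝ, 0 ≤ δ₁ → δ₁ ≤ 1 → 0 ≤ δ₂ →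
      δ₂ ≤ 1 → ∀ (r M : ℝ) (ψ : ℝ × ℝ → ℂ), r < r₀ → IsAmplitude r M ψ →
      1 ≤ max (|ξ| * δ₁ ^ a) (|ξ| * δ₂ ^ b) →
      ‖osc S c δ₁ δ₂ ξ ψ‖ ≤ K * M * (max (|ξ| * δ₁ ^ a) (|ξ| * δ₂ ^ b)) ^
        (-((2 * (a * b) : ℕ) : ℝ)⁻¹) := by
  obtain ⟨r₁, hr1, hr1', K₁, hK1, H1⟩ := exists_norm_osc_le_decay h.pos_left h.pos_right h.above c
    h.mem_left h.ne_left
  have h' := h.swap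
  obtain ⟨r₂, hr2, hr2', K₂, hK2, H2⟩ := exists_norm_osc_le_decay h'.pos_left h'.pos_right
    h'.above _ h'.mem_left h'.ne_left
  refine ⟨min r₁ r₂, lt_min hr1 hr2, (min_le_left _ _).trans hr1', max K₁ K₂,
    le_max_of_le_left hK1, ?_⟩
  intro δ₁ δ₂ ξ h1 h1' h2 h2' r M ψ hr hψ hmax
  have hM := hψ.nonneg
  have hexp : ∀ m : ℕ, 0 < m → m ≤ a * b →
      -((2 * m : ℕ) : ℝ)⁻¹ ≤ -((2 * (a * b) : ℕ) : ℝ)⁻¹ := by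
    intro m hm hm'
    rw [neg_le_neg_iff]
    apply inv_anti₀
    · exact_mod_cast Nat.mul_pos two_pos hm
    · exact_mod_cast Nat.mul_le_mul_left 2 hm'
  have ha := h.pos_left
  have hb := h.pos_right
  rcases le_total (δ₂ ^ b) (δ₁ ^ a) with hle | hle
  · have : max (|ξ| * δ₁ ^ a) (|ξ| * δ₂ ^ b) = |ξ| * δ₁ ^ a :=
      max_eq_left (by gcongr)
    rw [this] at hmax ⊢
    refine (H1 δ₁ δ₂ ξ h1 h1' h2 h2' hle hmax r M ψ (hr.trans_le (min_le_left _ _)) hψ).trans ?_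
    have h3 := Real.rpow_le_rpow_of_exponent_le hmax (hexp a ha (Nat.le_mul_of_pos_right _ hb))
    have h4 := le_max_left K₁ K₂
    gcongr
  · have : max (|ξ| * δ₁ ^ a) (|ξ| * δ₂ ^ b) = |ξ| * δ₂ ^ b :=
      max_eq_right (by gcongr)
    rw [this] at hmax ⊢
    rw [← osc_swap]
    refine (H2 δ₂ δ₁ ξ h2 h2' h1 h1' hle hmax r M _ (hr.trans_le (min_le_right _ _))
      hψ.swap).trans ?_
    have h3 := Real.rpow_le_rpow_of_exponent_le hmax (hexp b hb (Nat.le_mul_of_pos_left _ ha))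
    have h4 := le_max_right K₁ K₂
    gcongr

/-- Interpolating decay against cancellation removes the dependence on δ₂ and leaves a two-sided
gain in |ξ| δ₁^a alone. -/
theorem exists_norm_osc_le_fst {S : Finset (ℕ × ℕ)} {c : ℕ × ℕ → ℝ} {a b : ℕ}
    (h : IsAdmissible S c a b) :
    ∃ r₀ : ℝ, 0 < r₀ ∧ r₀ ≤ 1 ∧ ∃ K : ℝ, 0 ≤ K ∧ ∃ κ : ℝ, 0 < κ ∧
      ∀ δ₁ δ₂ ξ : ℝ, 0 ≤ δ₁ → δ₁ ≤ 1 → 0 ≤ δ₂ →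
      δ₂ ≤ 1 → ∀ (r M : ℝ) (ψ : ℝ × ℝ → ℂ), r < r₀ → IsAmplitude r M ψ →
      (∀ t, ∫ s, ψ (s, t) = 0) →
      ‖osc S c δ₁ δ₂ ξ ψ‖ ≤ K * M * (min (|ξ| * δ₁ ^ a) (|ξ| * δ₁ ^ a)⁻¹) ^ κ := by
  obtain ⟨r₀, hr0, hr1, K, hK, H⟩ := exists_norm_osc_le_max h
  have hab := Nat.mul_pos h.pos_left h.pos_right
  have hab' : (1 : ℝ) ≤ ((a * b : ℕ) : ℝ) := by exact_mod_cast hab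
  have hab2 : (1 : ℝ) ≤ ((2 * (a * b) : ℕ) : ℝ) := by
    exact_mod_cast (by omega : 1 ≤ 2 * (a * b))
  set A := ∑ e ∈ S, |c e| with hA
  have hA0 : 0 ≤ A := Finset.sum_nonneg fun _ _ => abs_nonneg _
  refine ⟨r₀, hr0, hr1, 2 * (K + 4 * A), by positivity,
    ((a * b : ℕ) : ℝ)⁻¹ * ((2 * (a * b) : ℕ) : ℝ)⁻¹ / 2, by positivity, ?_⟩
  intro δ₁ δ₂ ξ h1 h1' h2 h2' r M ψ hr hψ hc
  have hM := hψ.nonneg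
  have hY : 0 ≤ |ξ| * δ₂ ^ b := by positivity
  have := le_rpow_of_decay_of_cancel (m := ‖osc S c δ₁ δ₂ ξ ψ‖) (C := (K + 4 * A) * M)
    (X := |ξ| * δ₁ ^ a) (Y := |ξ| * δ₂ ^ b) (σ := ((2 * (a * b) : ℕ) : ℝ)⁻¹)
    (θ := ((a * b : ℕ) : ℝ)⁻¹) (by positivity) (by positivity) (by positivity)
    (inv_le_one_of_one_le₀ hab2) (by positivity) (inv_le_one_of_one_le₀ hab')
    (fun hmax => (H δ₁ δ₂ ξ h1 h1' h2 h2' r M ψ hr hψ hmax).trans (by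
      have : 0 ≤ max (|ξ| * δ₁ ^ a) (|ξ| * δ₂ ^ b) := le_max_of_le_right hY
      gcongr
      linarith))
    (fun hX => (norm_osc_le_of_cancel h.pos_left h.pos_right h.above c h1 h1' h2 h2' hX
      (hr.le.trans hr1) hψ hc).trans (by
      rw [← hA]
      set W := (|ξ| * δ₁ ^ a) ^ (((a * b : ℕ) : ℝ)⁻¹) * (1 + |ξ| * δ₂ ^ b) with hW
      have hW0 : 0 ≤ W := by positivity
      have : 0 ≤ K * M * W := by positivity
      linarith))
  refine this.trans_eq ?_
  ring

/-- The gain factor at scale `2⁻ʲ`. -/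
noncomputable def gain (κ : ℝ) (a : ℕ) (ξ : ℝ) (j : ℕ) : ℝ :=
  if j = 0 then 1 else (min (|ξ| * ((2 ^ j)⁻¹) ^ a) (|ξ| * ((2 ^ j)⁻¹) ^ a)⁻¹) ^ κ

theorem gain_nonneg (κ : ℝ) (a : ℕ) (ξ : ℝ) (j : ℕ) : 0 ≤ gain κ a ξ j := by
  unfold gain
  split_ifs
  · exact zero_le_one
  · exact Real.rpow_nonneg (min_inv_nonneg (by positivity)) _

/-- When both variables have cancellation, the bounds by g₁² and by g₂² combine to g₁ g₂ by a
geometric mean; this is why κ is half the smaller one-variable exponent. A variable with index 0 has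
no cancellation, and its gain is 1. -/
theorem exists_norm_osc_le_gain {S : Finset (ℕ × ℕ)} {c : ℕ × ℕ → ℝ} {a b : ℕ}
    (h : IsAdmissible S c a b) :
    ∃ r₀ : ℝ, 0 < r₀ ∧ r₀ ≤ 1 ∧ ∃ K : ℝ, 0 ≤ K ∧ ∃ κ : ℝ, 0 < κ ∧
      ∀ (ξ : ℝ) (j : ℕ × ℕ) (r M : ℝ) (ψ : ℝ × ℝ → ℂ), r < r₀ → IsAmplitude r M ψ →
      (j.1 ≠ 0 → ∀ t, ∫ s, ψ (s, t) = 0) → (j.2 ≠ 0 → ∀ s, ∫ t, ψ (s, t) = 0) →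
      ‖osc S c (2 ^ j.1)⁻¹ (2 ^ j.2)⁻¹ ξ ψ‖ ≤ K * M * (gain κ a ξ j.1 * gain κ b ξ j.2) := by
  obtain ⟨r₁, hr1, hr1', K₁, hK1, κ₁, hκ1, H1⟩ := exists_norm_osc_le_fst h
  obtain ⟨r₂, hr2, hr2', K₂, hK2, κ₂, hκ2, H2⟩ := exists_norm_osc_le_fst h.swap
  set K := max 4 (max K₁ K₂) with hKdef
  have hK4 : 4 ≤ K := le_max_left _ _
  have hKK1 : K₁ ≤ K := (le_max_left _ _).trans (le_max_right _ _)
  have hKK2 : K₂ ≤ K := (le_max_right _ _).trans (le_max_right _ _)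
  have hK : 0 ≤ K := by linarith
  set κ := min κ₁ κ₂ / 2 with hκdef
  have hκ : 0 < κ := by have := lt_min hκ1 hκ2; positivity
  have hκκ1 : κ * 2 ≤ κ₁ := by have := min_le_left κ₁ κ₂; linarith
  have hκκ2 : κ * 2 ≤ κ₂ := by have := min_le_right κ₁ κ₂; linarith
  refine ⟨min r₁ r₂, lt_min hr1 hr2, (min_le_left _ _).trans hr1', K, hK, κ, hκ, ?_⟩
  intro ξ j r M ψ hr hψ hc1 hc2
  have hM := hψ.nonneg
  have hpow : ∀ (i n : ℕ), 0 ≤ |ξ| * (((2 : ℝ) ^ i)⁻¹) ^ n := fun i n => by positivity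
  have hδ : ∀ i : ℕ, ((2 : ℝ) ^ i)⁻¹ ≤ 1 := fun i =>
    inv_le_one_of_one_le₀ (one_le_pow₀ one_le_two)
  have hδ0 : ∀ i : ℕ, 0 ≤ ((2 : ℝ) ^ i)⁻¹ := fun i => by positivity
  have hG : ∀ (x κ' : ℝ), 0 ≤ x → κ * 2 ≤ κ' → (min x x⁻¹) ^ κ' ≤ ((min x x⁻¹) ^ κ) ^ 2 := by
    intro x κ' hx hκ'
    rw [← Real.rpow_mul_natCast (min_inv_nonneg hx)]
    exact Real.rpow_le_rpow_of_exponent_ge' (min_inv_nonneg hx) (min_inv_le_one _)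
      (by positivity) (by exact_mod_cast hκ')
  have hG1 : ∀ x : ℝ, 0 ≤ x → (min x x⁻¹) ^ κ ≤ 1 := fun x hx =>
    Real.rpow_le_one (min_inv_nonneg hx) (min_inv_le_one _) hκ.le
  set m := ‖osc S c (2 ^ j.1)⁻¹ (2 ^ j.2)⁻¹ ξ ψ‖ with hm
  have hm0 : 0 ≤ m := norm_nonneg _
  set g₁ := (min (|ξ| * ((2 ^ j.1)⁻¹) ^ a) (|ξ| * ((2 ^ j.1)⁻¹) ^ a)⁻¹) ^ κ with hg1
  set g₂ := (min (|ξ| * ((2 ^ j.2)⁻¹) ^ b) (|ξ| * ((2 ^ j.2)⁻¹) ^ b)⁻¹) ^ κ with hg2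
  have hg10 : 0 ≤ g₁ := Real.rpow_nonneg (min_inv_nonneg (hpow _ _)) _
  have hg20 : 0 ≤ g₂ := Real.rpow_nonneg (min_inv_nonneg (hpow _ _)) _
  have hg11 : g₁ ≤ 1 := hG1 _ (hpow _ _)
  have hg21 : g₂ ≤ 1 := hG1 _ (hpow _ _)
  have hA : m ≤ K * M := (norm_osc_le S c _ _ ξ (hr.le.trans ((min_le_left _ _).trans hr1'))
    hψ).trans (by gcongr)
  have hB1 : j.1 ≠ 0 → m ≤ K * M * g₁ ^ 2 := fun hj =>
    (H1 _ _ ξ (hδ0 j.1) (hδ _) (hδ0 j.2) (hδ _) r M ψ (hr.trans_le (min_le_left _ _)) hψ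
      (hc1 hj)).trans (by
        have := hG _ _ (hpow j.1 a) hκκ1
        gcongr)
  have hB2 : j.2 ≠ 0 → m ≤ K * M * g₂ ^ 2 := fun hj => by
    rw [hm, ← osc_swap]
    exact (H2 _ _ ξ (hδ0 j.2) (hδ _) (hδ0 j.1) (hδ _) r M _ (hr.trans_le (min_le_right _ _))
      hψ.swap (hc2 hj)).trans (by
        have := hG _ _ (hpow j.2 b) hκκ2
        gcongr)
  have hKM : 0 ≤ K * M := by positivity
  unfold gain
  rw [← hg1, ← hg2]
  by_cases h1 : j.1 = 0 <;> by_cases h2 : j.2 = 0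
  · rw [if_pos h1, if_pos h2]; linarith
  · rw [if_pos h1, if_neg h2, one_mul]
    refine (hB2 h2).trans ?_
    gcongr
    exact pow_le_of_le_one hg20 hg21 two_ne_zero
  · rw [if_neg h1, if_pos h2, mul_one]
    refine (hB1 h1).trans ?_
    gcongr
    exact pow_le_of_le_one hg10 hg11 two_ne_zero
  · rw [if_neg h1, if_neg h2]
    rw [← pow_le_pow_iff_left₀ hm0 (by positivity) two_ne_zero]
    calc m ^ 2 = m * m := sq m
      _ ≤ (K * M * g₁ ^ 2) * (K * M * g₂ ^ 2) :=
          mul_le_mul (hB1 h1) (hB2 h2) hm0 (by positivity)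
      _ = _ := by ring

/-- The gain factors are summable over all scales, uniformly in the frequency. -/
theorem exists_sum_gain_le {κ : ℝ} (hκ : 0 < κ) {a : ℕ} (ha : 0 < a) :
    ∃ B : ℝ, 0 ≤ B ∧ ∀ (ξ : ℝ) (F : Finset ℕ), ∑ j ∈ F, gain κ a ξ j ≤ B := by
  set y : ℝ := 2 ^ a with hy
  have hy1 : 1 < y := one_lt_pow₀ one_lt_two ha.ne'
  have hy0 : 0 < y := by linarith
  set ρ : ℝ := y ^ (-κ) with hρ
  have hρ0 : 0 < ρ := Real.rpow_pos_of_pos hy0 _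
  have hρ1 : ρ < 1 := Real.rpow_lt_one_of_one_lt_of_neg hy1 (by linarith)
  have hsum : Summable fun k : ℤ => ρ ^ k.natAbs := by
    refine Summable.of_nat_of_neg ?_ ?_ <;>
    simpa using summable_geometric_of_lt_one hρ0.le hρ1
  set T := ∑' k : ℤ, ρ ^ k.natAbs with hT
  have hT0 : 0 ≤ T := tsum_nonneg fun _ => by positivity
  refine ⟨1 + y ^ κ * T, by positivity, fun ξ F => ?_⟩
  have hmain : ∑ j ∈ F, (min (|ξ| * ((2 ^ j)⁻¹) ^ a) (|ξ| * ((2 ^ j)⁻¹) ^ a)⁻¹) ^ κ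
      ≤ y ^ κ * T := by
    rcases eq_or_ne ξ 0 with rfl | hξ
    · simp only [abs_zero, zero_mul, inv_zero, min_self, Real.zero_rpow hκ.ne',
        Finset.sum_const_zero]
      positivity
    -- With y^n ≤ |ξ| < y^(n+1), the gain decays geometrically in |j - n|, so the sum does not
    -- depend on where ξ lies.
    obtain ⟨n, hn1, hn2⟩ := exists_mem_Ico_zpow (abs_pos.2 hξ) hy1
    have hterm : ∀ j : ℕ, (min (|ξ| * ((2 ^ j)⁻¹) ^ a) (|ξ| * ((2 ^ j)⁻¹) ^ a)⁻¹) ^ κ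
        ≤ y ^ κ * ρ ^ ((j : ℤ) - n).natAbs := by
      intro j
      have hX : |ξ| * ((2 ^ j : ℝ)⁻¹) ^ a = |ξ| * y ^ (-(j : ℤ)) := by
        rw [hy, zpow_neg, zpow_natCast, inv_pow, ← pow_mul, ← pow_mul, mul_comm j]
      have hle : min (|ξ| * ((2 ^ j : ℝ)⁻¹) ^ a) (|ξ| * ((2 ^ j)⁻¹) ^ a)⁻¹
          ≤ y * y ^ (-(((j : ℤ) - n).natAbs : ℤ)) := by
        rw [hX]
        rcases le_total n (j : ℤ) with h | h
        · refine (min_le_left _ _).trans ?_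
          calc |ξ| * y ^ (-(j : ℤ)) ≤ y ^ (n + 1) * y ^ (-(j : ℤ)) := by gcongr
            _ = y * y ^ (-(((j : ℤ) - n).natAbs : ℤ)) := by
              rw [← zpow_add₀ hy0.ne', ← zpow_one_add₀ hy0.ne']
              congr 1; omega
        · refine (min_le_right _ _).trans ?_
          calc (|ξ| * y ^ (-(j : ℤ)))⁻¹ ≤ (y ^ n * y ^ (-(j : ℤ)))⁻¹ := by gcongr
            _ = y ^ (-(((j : ℤ) - n).natAbs : ℤ)) := by
              rw [← zpow_add₀ hy0.ne', ← zpow_neg]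
              congr 1; omega
            _ ≤ _ := le_mul_of_one_le_left (by positivity) hy1.le
      calc _ ≤ (y * y ^ (-(((j : ℤ) - n).natAbs : ℤ))) ^ κ :=
            Real.rpow_le_rpow (min_inv_nonneg (by positivity)) hle hκ.le
        _ = y ^ κ * ρ ^ ((j : ℤ) - n).natAbs := by
            rw [Real.mul_rpow hy0.le (by positivity), zpow_neg, zpow_natCast, hρ,
              Real.inv_rpow (by positivity), ← Real.rpow_natCast, ← Real.rpow_natCast,
              ← Real.rpow_mul hy0.le, ← Real.rpow_mul hy0.le, ← Real.rpow_neg hy0.le]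
            congr 2; ring
    refine (Finset.sum_le_sum fun j _ => hterm j).trans ?_
    rw [← Finset.mul_sum]
    refine mul_le_mul_of_nonneg_left ?_ (by positivity)
    have hinj : Function.Injective fun j : ℕ => (j : ℤ) - n := fun i j hij => by
      simp only at hij; omega
    rw [← Finset.sum_image (f := fun k : ℤ => ρ ^ k.natAbs) hinj.injOn]
    exact hsum.sum_le_tsum _ fun _ _ => by positivity
  calc ∑ j ∈ F, gain κ a ξ j ≤ ∑ j ∈ F, ((if j = 0 then 1 else 0) +
        (min (|ξ| * ((2 ^ j)⁻¹) ^ a) (|ξ| * ((2 ^ j)⁻¹) ^ a)⁻¹) ^ κ) := by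
        refine Finset.sum_le_sum fun j _ => ?_
        have : 0 ≤ (min (|ξ| * ((2 ^ j)⁻¹) ^ a) (|ξ| * ((2 ^ j)⁻¹) ^ a)⁻¹) ^ κ :=
          Real.rpow_nonneg (min_inv_nonneg (by positivity)) _
        unfold gain
        split_ifs <;> linarith
    _ ≤ 1 + y ^ κ * T := by
        rw [Finset.sum_add_distrib]
        refine add_le_add ?_ hmain
        rw [Finset.sum_ite_eq']
        split_ifs <;> norm_num

theorem sum_gain_mul_gain_le {κ : ℝ} {a b : ℕ} {ξ A B : ℝ} (hA0 : 0 ≤ A)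
    (hA : ∀ F : Finset ℕ, ∑ j ∈ F, gain κ a ξ j ≤ A)
    (hB : ∀ F : Finset ℕ, ∑ j ∈ F, gain κ b ξ j ≤ B) (F : Finset (ℕ × ℕ)) :
    ∑ j ∈ F, gain κ a ξ j.1 * gain κ b ξ j.2 ≤ A * B := by
  calc _ ≤ ∑ j ∈ F.image Prod.fst ×ˢ F.image Prod.snd, gain κ a ξ j.1 * gain κ b ξ j.2 :=
        Finset.sum_le_sum_of_subset_of_nonneg Finset.subset_product
          fun _ _ _ => mul_nonneg (gain_nonneg _ _ _ _) (gain_nonneg _ _ _ _)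
    _ = (∑ j ∈ F.image Prod.fst, gain κ a ξ j) * ∑ j ∈ F.image Prod.snd, gain κ b ξ j := by
        rw [Finset.sum_mul_sum, Finset.sum_product]
    _ ≤ A * B := mul_le_mul (hA _) (hB _) (Finset.sum_nonneg fun _ _ => gain_nonneg _ _ _ _) hA0

end TransInv

/-! ### Fourier multipliers and L² bounds for sums of dilates. -/

namespace TransInv

open Set Filter

/-- Averages of translates `∫ f(x - P(z)) g(z) dz`. -/
noncomputable def avgTranslate (P : ℝ × ℝ → ℝ) (g : ℝ × ℝ → ℂ) (f : ℝ → ℂ) (x : ℝ) : ℂ :=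
  ∫ z, f (x - P z) * g z

section avgTranslate

variable {P : ℝ × ℝ → ℝ} {g : ℝ × ℝ → ℂ} {f : ℝ → ℂ}

theorem integrable_avgTranslate (hP : Continuous P) (hg : Continuous g)
    (hgs : HasCompactSupport g) (hf : Continuous f) (x : ℝ) :
    Integrable fun z => f (x - P z) * g z :=
  ((hf.comp (continuous_const.sub hP)).mul hg).integrable_of_hasCompactSupport hgs.mul_left

theorem hasDerivAt_avgTranslate (hP : Continuous P) (hg : Continuous g)
    (hgs : HasCompactSupport g) (hf : ContDiff ℝ 1 f) (hfs : HasCompactSupport f) (x : ℝ) :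
    HasDerivAt (avgTranslate P g f) (avgTranslate P g (deriv f) x) x := by
  have hf' : Continuous (deriv f) := hf.continuous_deriv le_rfl
  obtain ⟨B, hB⟩ := hfs.deriv.exists_bound_of_continuous hf'
  refine (hasDerivAt_integral_of_dominated_loc_of_deriv_le (s := univ)
    (F := fun x z => f (x - P z) * g z) (F' := fun x z => deriv f (x - P z) * g z)
    (bound := fun z => B * ‖g z‖) univ_mem
    (Eventually.of_forall fun y =>
      (integrable_avgTranslate hP hg hgs hf.continuous y).aestronglyMeasurable)
    (integrable_avgTranslate hP hg hgs hf.continuous x)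
    (integrable_avgTranslate hP hg hgs hf' x).aestronglyMeasurable
    (Eventually.of_forall fun z y _ => ?_)
    ((hg.integrable_of_hasCompactSupport hgs).norm.const_mul B)
    (Eventually.of_forall fun z y _ => ?_)).2
  · rw [norm_mul]
    exact mul_le_mul_of_nonneg_right (hB _) (norm_nonneg _)
  · have h1 : HasDerivAt f (deriv f (y - P z)) (y - P z) :=
      (hf.differentiable one_ne_zero _).hasDerivAt
    exact (h1.comp_sub_const y (P z)).mul_const (g z)

/-- Together with compact support, this makes Plancherel for Schwartz functions available. -/
theorem contDiff_avgTranslate (hP : Continuous P) (hg : Continuous g)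
    (hgs : HasCompactSupport g) (hf : ContDiff ℝ ∞ f) (hfs : HasCompactSupport f) :
    ContDiff ℝ ∞ (avgTranslate P g f) := by
  rw [contDiff_infty]
  intro n
  induction n generalizing f with
  | zero =>
    refine contDiff_zero.2 (continuous_iff_continuousAt.2 fun x => ?_)
    exact (hasDerivAt_avgTranslate hP hg hgs (hf.of_le (by simp)) hfs x).continuousAt
  | succ n ih =>
    have hd := hasDerivAt_avgTranslate hP hg hgs (hf.of_le (by simp)) hfs
    push_cast
    refine contDiff_succ_iff_deriv.2 ⟨fun x => (hd x).differentiableAt, by simp, ?_⟩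
    rw [funext fun x => (hd x).deriv]
    exact ih (contDiff_infty_iff_deriv.1 hf).2 hfs.deriv

theorem exists_bounds_support (hP : Continuous P) (hgs : HasCompactSupport g)
    (hfs : HasCompactSupport f) :
    ∃ R : ℝ, ∀ x z, f (x - P z) * g z ≠ 0 → |x| ≤ R := by
  obtain ⟨Q, hQ⟩ := hgs.isCompact.exists_bound_of_continuousOn hP.continuousOn
  obtain ⟨R, hR⟩ := hfs.isCompact.isBounded.exists_norm_le
  refine ⟨R + Q, fun x z h => ?_⟩
  have h1 := hR _ (subset_tsupport _ (left_ne_zero_of_mul h))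
  have h2 := hQ z (subset_tsupport _ (right_ne_zero_of_mul h))
  rw [Real.norm_eq_abs] at h1 h2
  calc |x| = |(x - P z) + P z| := by ring_nf
    _ ≤ _ := (abs_add_le _ _).trans (add_le_add h1 h2)

theorem hasCompactSupport_avgTranslate (hP : Continuous P) (hgs : HasCompactSupport g)
    (hfs : HasCompactSupport f) : HasCompactSupport (avgTranslate P g f) := by
  obtain ⟨R, hR⟩ := exists_bounds_support hP hgs hfs
  refine HasCompactSupport.of_support_subset_isCompact (isCompact_Icc (a := -R) (b := R))
    fun x hx => ?_
  obtain ⟨z, hz⟩ := exists_ne_zero_of_integral_ne_zero hx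
  exact abs_le.1 (hR x z hz)

-- Fubini, then the translation x ↦ x + P(z) in the inner integral.
open FourierTransform in
theorem fourier_avgTranslate (hP : Continuous P) (hg : Continuous g)
    (hgs : HasCompactSupport g) (hf : Continuous f) (hfs : HasCompactSupport f) (ξ : ℝ) :
    𝓕 (avgTranslate P g f) ξ =
      (∫ z, g z * Complex.exp (Complex.I * ((-2 * Real.pi * ξ) * P z : ℝ))) * 𝓕 f ξ := by
  obtain ⟨R, hR⟩ := exists_bounds_support hP hgs hfs
  have hint : Integrable (Function.uncurry fun (x : ℝ) (z : ℝ × ℝ) =>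
      Complex.exp (((-2 * Real.pi * x * ξ : ℝ) : ℂ) * Complex.I) * (f (x - P z) * g z))
      (volume.prod volume) := by
    refine Continuous.integrable_of_hasCompactSupport ?_ ?_
    · simp only [Function.uncurry_def]
      fun_prop
    · refine HasCompactSupport.of_support_subset_isCompact
        ((isCompact_Icc (a := -R) (b := R)).prod hgs.isCompact) fun w hw => ?_
      have hw' := right_ne_zero_of_mul hw
      exact ⟨abs_le.1 (hR _ _ hw'), subset_tsupport _ (right_ne_zero_of_mul hw')⟩
  rw [Real.fourier_real_eq_integral_exp_smul, Real.fourier_real_eq_integral_exp_smul]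
  have hL : ∀ x : ℝ, Complex.exp (((-2 * Real.pi * x * ξ : ℝ) : ℂ) * Complex.I) •
      avgTranslate P g f x =
      ∫ z, Complex.exp (((-2 * Real.pi * x * ξ : ℝ) : ℂ) * Complex.I) * (f (x - P z) * g z) :=
    fun x => by rw [integral_const_mul]; rfl
  simp only [hL, smul_eq_mul]
  rw [integral_integral_swap hint, ← integral_mul_const]
  congr 1 with z
  rw [← integral_sub_right_eq_self (fun x : ℝ =>
    Complex.exp (((-2 * Real.pi * x * ξ : ℝ) : ℂ) * Complex.I) * f x) (P z), ← integral_const_mul]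
  congr 1 with x
  have : Complex.exp (((-2 * Real.pi * x * ξ : ℝ) : ℂ) * Complex.I) =
      Complex.exp (Complex.I * ((-2 * Real.pi * ξ) * P z : ℝ)) *
      Complex.exp (((-2 * Real.pi * (x - P z) * ξ : ℝ) : ℂ) * Complex.I) := by
    rw [← Complex.exp_add]
    push_cast
    ring_nf
  rw [this]
  ring

open FourierTransform SchwartzMap in
theorem eLpNorm_fourier_eq (hf : ContDiff ℝ ∞ f) (hfs : HasCompactSupport f) :
    eLpNorm (𝓕 f) 2 volume = eLpNorm f 2 volume := by
  have := SchwartzMap.norm_fourier_toL2_eq (hfs.toSchwartzMap hf)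
  rw [SchwartzMap.norm_toLp, SchwartzMap.norm_toLp, ENNReal.toReal_eq_toReal_iff'
    (SchwartzMap.memLp _ _ _).eLpNorm_ne_top (SchwartzMap.memLp _ _ _).eLpNorm_ne_top,
    SchwartzMap.fourier_coe] at this
  exact this

theorem eLpNorm_avgTranslate_le (hP : Continuous P) (hg : Continuous g)
    (hgs : HasCompactSupport g) (hf : ContDiff ℝ ∞ f) (hfs : HasCompactSupport f) {C : ℝ≥0}
    (hC : ∀ ξ : ℝ, ‖∫ z, g z * Complex.exp (Complex.I * (ξ * P z : ℝ))‖ ≤ C) :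
    eLpNorm (avgTranslate P g f) 2 volume ≤ C * eLpNorm f 2 volume := by
  rw [← eLpNorm_fourier_eq (contDiff_avgTranslate hP hg hgs hf hfs)
    (hasCompactSupport_avgTranslate hP hgs hfs), ← eLpNorm_fourier_eq hf hfs]
  refine eLpNorm_le_nnreal_smul_eLpNorm_of_ae_le_mul (Eventually.of_forall fun ξ => ?_) 2
  rw [fourier_avgTranslate hP hg hgs hf.continuous hfs, nnnorm_mul]
  gcongr
  exact hC _

end avgTranslate

section kernel

variable {a₀ : ℝ} {ς : ℕ × ℕ → ℝ × ℝ → ℂ}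

theorem continuous_dilate (j : ℕ × ℕ) {g : ℝ × ℝ → ℂ} (hg : Continuous g) :
    Continuous (dilate j g) := by
  unfold dilate; fun_prop

theorem abs_le_of_dilate_ne_zero {j : ℕ × ℕ} {g : ℝ × ℝ → ℂ} {r : ℝ}
    (hg : ∀ z, g z ≠ 0 → |z.1| ≤ r ∧ |z.2| ≤ r) (z : ℝ × ℝ) (hz : dilate j g z ≠ 0) :
    |z.1| ≤ r ∧ |z.2| ≤ r := by
  have key : ∀ (i : ℕ) (x : ℝ), |2 ^ i * x| ≤ r → |x| ≤ r := fun i x hx => by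
    refine le_trans ?_ hx
    rw [abs_mul, abs_pow, abs_two]
    exact le_mul_of_one_le_left (abs_nonneg _) (one_le_pow₀ one_le_two)
  obtain ⟨h1, h2⟩ := hg _ (right_ne_zero_of_mul hz)
  exact ⟨key _ _ h1, key _ _ h2⟩

theorem IsKernelFamily.exists_square (h : IsKernelFamily a₀ ς) :
    ∃ r : ℝ, r < a₀ ∧ ∀ j z, ς j z ≠ 0 → |z.1| ≤ r ∧ |z.2| ≤ r := by
  obtain ⟨r, hr0, hr, hz⟩ := h.supp
  refine ⟨r, hr, fun j z hjz => ⟨?_, ?_⟩⟩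
  · exact abs_le_of_sq_le_sq (by nlinarith [hz j z hjz, sq_nonneg z.2]) hr0
  · exact abs_le_of_sq_le_sq (by nlinarith [hz j z hjz, sq_nonneg z.1]) hr0

theorem hasSum_pairing {K : 𝓓'((⊤ : Opens (ℝ × ℝ)), ℂ)} {g : ℕ × ℕ → ℝ × ℝ → ℂ}
    (hg : ∀ j, Continuous (g j))
    (hK : ∀ φ : 𝓓((⊤ : Opens (ℝ × ℝ)), ℝ),
      HasSum (fun j : ℕ × ℕ => ∫ z : ℝ × ℝ, (φ z : ℂ) * g j z) (K φ))
    (φ : 𝓓((⊤ : Opens (ℝ × ℝ)), ℂ)) :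
    HasSum (fun j => ∫ z, φ z * g j z) (pairing K φ) := by
  have h1 := hK (TestFunction.postcompCLM Complex.reCLM φ)
  have h2 := (hK (TestFunction.postcompCLM Complex.imCLM φ)).mul_left Complex.I
  refine (h1.add h2).congr_fun fun j => ?_
  have hint : ∀ L : ℂ →L[ℝ] ℝ,
      Integrable fun z => ((TestFunction.postcompCLM L φ z : ℝ) : ℂ) * g j z := fun L =>
    ((Complex.continuous_ofReal.comp (TestFunction.continuous _)).mul
      (hg j)).integrable_of_hasCompactSupport
      ((TestFunction.hasCompactSupport _).comp_left Complex.ofReal_zero).mul_right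
  rw [← integral_const_mul, ← integral_add (hint _) ((hint _).const_mul _)]
  congr 1 with z
  rw [← mul_assoc, ← add_mul]
  congr 1
  simp only [TestFunction.postcompCLM_apply, Function.comp_apply, Complex.reCLM_apply,
    Complex.imCLM_apply]
  rw [mul_comm Complex.I, Complex.re_add_im]

/-- The dilates live where |s|, |t| < a₀ ≤ 1, and there the cutoff in `translate` equals 1. -/
theorem hasSum_opT {p : MvPolynomial (Fin 2) ℝ} {K : 𝓓'((⊤ : Opens (ℝ × ℝ)), ℂ)} (ha₀ : a₀ ≤ 1)
    (h : IsKernelFamily a₀ ς)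
    (hK : ∀ φ : 𝓓((⊤ : Opens (ℝ × ℝ)), ℝ),
      HasSum (fun j : ℕ × ℕ => ∫ z : ℝ × ℝ, (φ z : ℂ) * dilate j (ς j) z) (K φ))
    (f : 𝓓((⊤ : Opens ℝ), ℂ)) (x : ℝ) :
    HasSum (fun j => avgTranslate (polyFun p) (dilate j (ς j)) f x) (opT p K f x) := by
  refine (hasSum_pairing (fun j => continuous_dilate j (h.smooth j).continuous) hK
    (translate p f x)).congr_fun fun j => ?_
  obtain ⟨r, hr, hsq⟩ := h.exists_square
  unfold avgTranslate
  congr 1 with z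
  by_cases hz : dilate j (ς j) z = 0
  · rw [hz, mul_zero, mul_zero]
  · obtain ⟨h1, h2⟩ := abs_le_of_dilate_ne_zero (hsq j) z hz
    have hc : cutoff z = 1 := by
      refine cutoff.one_of_mem_closedBall ?_
      rw [mem_closedBall_zero_iff, Prod.norm_def]
      exact max_le (by rw [Real.norm_eq_abs]; exact h1.trans (hr.le.trans ha₀))
        (by rw [Real.norm_eq_abs]; exact h2.trans (hr.le.trans ha₀))
    have : translate p f x z = cutoff z • f (x - polyFun p z) := rfl
    rw [this, hc, one_smul]

/-- Finite partial sums are bounded on L² uniformly, by Plancherel, and converge pointwise to `opT p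
K f`; Fatou's lemma passes the bound to the limit. -/
theorem isL2Bounded_opT {p : MvPolynomial (Fin 2) ℝ} {K : 𝓓'((⊤ : Opens (ℝ × ℝ)), ℂ)}
    (ha₀ : a₀ ≤ 1) (h : IsKernelFamily a₀ ς)
    (hK : ∀ φ : 𝓓((⊤ : Opens (ℝ × ℝ)), ℝ),
      HasSum (fun j : ℕ × ℕ => ∫ z : ℝ × ℝ, (φ z : ℂ) * dilate j (ς j) z) (K φ))
    {C : ℝ≥0} (hC : ∀ (F : Finset (ℕ × ℕ)) (ξ : ℝ), ∑ j ∈ F,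
      ‖∫ z, dilate j (ς j) z * Complex.exp (Complex.I * (ξ * polyFun p z : ℝ))‖ ≤ C) :
    IsL2Bounded (opT p K) := by
  refine ⟨C, fun f => ?_⟩
  obtain ⟨r, hr, hsq⟩ := h.exists_square
  have hP : Continuous (polyFun p) := (contDiff_polyFun p).continuous
  have hcont : ∀ j, Continuous (dilate j (ς j)) := fun j =>
    continuous_dilate j (h.smooth j).continuous
  have hcs : ∀ j, HasCompactSupport (dilate j (ς j)) := fun j =>
    hasCompactSupport_of_square (abs_le_of_dilate_ne_zero (hsq j))
  have hfc : Continuous f := f.continuous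
  have hfd : ContDiff ℝ ∞ f := f.contDiff
  set T : Finset (ℕ × ℕ) → ℝ → ℂ := fun F =>
    avgTranslate (polyFun p) (fun z => ∑ j ∈ F, dilate j (ς j) z) f with hT
  have hTsum : ∀ F x, T F x = ∑ j ∈ F, avgTranslate (polyFun p) (dilate j (ς j)) f x := by
    intro F x
    simp only [hT, avgTranslate, Finset.mul_sum]
    exact integral_finsetSum _ fun j _ => integrable_avgTranslate hP (hcont j) (hcs j) hfc x
  have hFc : ∀ F : Finset (ℕ × ℕ), Continuous fun z => ∑ j ∈ F, dilate j (ς j) z := fun F =>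
    continuous_finsetSum _ fun j _ => hcont j
  have hFs : ∀ F : Finset (ℕ × ℕ), HasCompactSupport fun z => ∑ j ∈ F, dilate j (ς j) z := by
    intro F
    refine hasCompactSupport_of_square (r := r) fun z hz => ?_
    obtain ⟨j, _, hj⟩ := Finset.exists_ne_zero_of_sum_ne_zero hz
    exact abs_le_of_dilate_ne_zero (hsq j) z hj
  have hTbound : ∀ F, eLpNorm (T F) 2 volume ≤ C * eLpNorm f 2 volume := by
    intro F
    refine eLpNorm_avgTranslate_le hP (hFc F) (hFs F) hfd f.hasCompactSupport fun ξ => ?_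
    simp only [Finset.sum_mul]
    rw [integral_finsetSum]
    · exact (norm_sum_le _ _).trans (hC F ξ)
    · intro j _
      exact ((hcont j).mul (by fun_prop)).integrable_of_hasCompactSupport (hcs j).mul_right
  have hTcont : ∀ F, Continuous (T F) := fun F =>
    (contDiff_avgTranslate hP (hFc F) (hFs F) hfd f.hasCompactSupport).continuous
  -- Fatou's lemma is applied along a sequence of finite index sets tending to `atTop`.
  obtain ⟨u, hu⟩ := exists_seq_tendsto (atTop : Filter (Finset (ℕ × ℕ)))
  have hlim : ∀ x, Tendsto (fun n => T (u n) x) atTop (nhds (opT p K f x)) := by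
    intro x
    simp only [hTsum]
    exact (hasSum_opT ha₀ h hK f x : Tendsto _ _ _).comp hu
  have hmeas : ∀ n, AEStronglyMeasurable (T (u n)) volume := fun n =>
    (hTcont _).aestronglyMeasurable
  have hle : eLpNorm (opT p K f) 2 volume ≤ C * eLpNorm f 2 volume :=
    (Lp.eLpNorm_lim_le_liminf_eLpNorm hmeas _ (Eventually.of_forall hlim)).trans
      (liminf_le_of_frequently_le' (Frequently.of_forall fun n => hTbound _))
  refine ⟨⟨aestronglyMeasurable_of_tendsto_ae atTop hmeas (Eventually.of_forall hlim), ?_⟩, hle⟩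
  refine hle.trans_lt (ENNReal.mul_lt_top ENNReal.coe_lt_top ?_)
  exact (hfc.memLp_of_hasCompactSupport f.hasCompactSupport).eLpNorm_lt_top

end kernel

end TransInv

/-! ### The multiplier of p at each scale, and sufficiency of the condition. -/

namespace TransInv

open Set Filter

/-- The exponents of `p`. -/
def exponents (p : MvPolynomial (Fin 2) ℝ) : Finset (ℕ × ℕ) :=
  p.support.image fun d => (d 0, d 1)

theorem coeffAt_apply (p : MvPolynomial (Fin 2) ℝ) (d : Fin 2 →₀ ℕ) :
    coeffAt p (d 0) (d 1) = p.coeff d := by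
  unfold coeffAt
  congr 1
  ext i
  fin_cases i <;> simp

theorem mem_exponents {p : MvPolynomial (Fin 2) ℝ} {e : ℕ × ℕ} :
    e ∈ exponents p ↔ coeffAt p e.1 e.2 ≠ 0 := by
  simp only [exponents, Finset.mem_image, MvPolynomial.mem_support_iff]
  constructor
  · rintro ⟨d, hd, rfl⟩
    rwa [coeffAt_apply]
  · intro h
    exact ⟨_, h, by simp⟩

theorem polyFun_eq (p : MvPolynomial (Fin 2) ℝ) (z : ℝ × ℝ) :
    polyFun p z = monoSum (exponents p) (fun e => coeffAt p e.1 e.2) z.1 z.2 := by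
  unfold polyFun monoSum exponents
  rw [MvPolynomial.eval_eq', Finset.sum_image]
  · refine Finset.sum_congr rfl fun d _ => ?_
    simp [coeffAt_apply, Fin.prod_univ_two]
  · intro d _ d' _ hdd'
    ext i
    fin_cases i
    · exact congrArg Prod.fst hdd'
    · exact congrArg Prod.snd hdd'

/-- Change of variables, one coordinate at a time: scales move from the kernel to the function it is
paired with. -/
theorem integral_dilate_mul (j : ℕ × ℕ) {g h : ℝ × ℝ → ℂ} (hg : Continuous g)
    (hgs : ∃ r : ℝ, ∀ z, g z ≠ 0 → |z.1| ≤ r ∧ |z.2| ≤ r) (hh : Continuous h) :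
    ∫ z, dilate j g z * h z = ∫ z : ℝ × ℝ, g z * h ((2 ^ j.1)⁻¹ * z.1, (2 ^ j.2)⁻¹ * z.2) := by
  obtain ⟨r, hr⟩ := hgs
  have h1 : Integrable fun z => dilate j g z * h z :=
    ((continuous_dilate j hg).mul hh).integrable_of_hasCompactSupport
      (hasCompactSupport_of_square (abs_le_of_dilate_ne_zero hr)).mul_right
  have h2 : Integrable fun z : ℝ × ℝ => g z * h ((2 ^ j.1)⁻¹ * z.1, (2 ^ j.2)⁻¹ * z.2) :=
    (hg.mul (by fun_prop)).integrable_of_hasCompactSupport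
      (hasCompactSupport_of_square hr).mul_right
  rw [Measure.volume_eq_prod] at h1 h2 ⊢
  rw [integral_prod _ h1, integral_prod _ h2]
  set Φ : ℝ → ℝ → ℂ := fun s t => g (s, t) * h ((2 ^ j.1)⁻¹ * s, (2 ^ j.2)⁻¹ * t) with hΦ
  change _ = ∫ s, ∫ t, Φ s t
  have h3 : ∀ s t : ℝ, dilate j g (s, t) * h (s, t) =
      2 ^ (j.1 + j.2) * Φ (2 ^ j.1 * s) (2 ^ j.2 * t) := by
    intro s t
    simp only [hΦ, dilate, inv_mul_cancel_left₀ (pow_ne_zero _ (two_ne_zero : (2 : ℝ) ≠ 0))]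
    ring
  simp only [h3]
  have h4 : ∀ s : ℝ, ∫ t, (2 : ℂ) ^ (j.1 + j.2) * Φ (2 ^ j.1 * s) (2 ^ j.2 * t) =
      2 ^ j.1 * ∫ t, Φ (2 ^ j.1 * s) t := by
    intro s
    rw [integral_const_mul, Measure.integral_comp_mul_left (fun t => Φ (2 ^ j.1 * s) t),
      abs_of_pos (by positivity), Complex.real_smul, pow_add]
    push_cast
    field_simp
  simp only [h4]
  rw [integral_const_mul, Measure.integral_comp_mul_left (fun s => ∫ t, Φ s t),
    abs_of_pos (by positivity), Complex.real_smul]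
  push_cast
  field_simp

theorem integral_dilate_mul_exp (p : MvPolynomial (Fin 2) ℝ) (j : ℕ × ℕ) (ξ : ℝ)
    {g : ℝ × ℝ → ℂ} (hg : Continuous g)
    (hgs : ∃ r : ℝ, ∀ z, g z ≠ 0 → |z.1| ≤ r ∧ |z.2| ≤ r) :
    ∫ z, dilate j g z * Complex.exp (Complex.I * (ξ * polyFun p z : ℝ)) =
      osc (exponents p) (fun e => coeffAt p e.1 e.2) (2 ^ j.1)⁻¹ (2 ^ j.2)⁻¹ ξ g := by
  have hP : Continuous (polyFun p) := (contDiff_polyFun p).continuous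
  rw [integral_dilate_mul j hg hgs (by fun_prop)]
  simp only [polyFun_eq]
  rfl

theorem IsKernelFamily.exists_isAmplitude {a₀ : ℝ} {ς : ℕ × ℕ → ℝ × ℝ → ℂ}
    (h : IsKernelFamily a₀ ς) :
    ∃ r M : ℝ, r < a₀ ∧ ∀ j, IsAmplitude r M (ς j) := by
  obtain ⟨r, hr, hsq⟩ := h.exists_square
  obtain ⟨C₀, hC₀⟩ := h.bounded 0
  obtain ⟨C₁, hC₁⟩ := h.bounded 1
  refine ⟨r, max C₀ C₁, hr, fun j => ⟨(h.smooth j).of_le (by simp), hsq j, fun z => ?_,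
    fun z => ?_⟩⟩
  · exact le_max_of_le_left (by simpa using hC₀ j z)
  · exact le_max_of_le_right (by simpa [norm_iteratedFDeriv_one] using hC₁ j z)

theorem exists_forall_isL2Bounded (p : MvPolynomial (Fin 2) ℝ) {a b : ℕ}
    (h : IsAdmissible (exponents p) (fun e => coeffAt p e.1 e.2) a b) :
    ∃ a₀ : ℝ, 0 < a₀ ∧ a₀ ≤ 1 ∧ ∀ K : 𝓓'((⊤ : Opens (ℝ × ℝ)), ℂ),
        IsProductKernel a₀ K → IsL2Bounded (opT p K) := by
  obtain ⟨a₀, ha0, ha1, K₀, hK0, κ, hκ, H⟩ := exists_norm_osc_le_gain h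
  obtain ⟨A, hA0, hA⟩ := exists_sum_gain_le hκ h.pos_left
  obtain ⟨B, hB0, hB⟩ := exists_sum_gain_le hκ h.pos_right
  refine ⟨a₀, ha0, ha1, fun K ⟨ς, hς, hK⟩ => ?_⟩
  obtain ⟨r, M, hr, hamp⟩ := hς.exists_isAmplitude
  have hM : 0 ≤ M := (hamp 0).nonneg
  refine isL2Bounded_opT (C := (K₀ * M * (A * B)).toNNReal) ha1 hς hK fun F ξ => ?_
  rw [Real.coe_toNNReal _ (by positivity)]
  calc _ ≤ ∑ j ∈ F, K₀ * M * (gain κ a ξ j.1 * gain κ b ξ j.2) := by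
        refine Finset.sum_le_sum fun j _ => ?_
        rw [integral_dilate_mul_exp p j ξ (hς.smooth j).continuous ⟨r, (hamp j).supp⟩]
        exact H ξ j r M (ς j) hr (hamp j) (hς.cancel_fst j) (hς.cancel_snd j)
    _ ≤ K₀ * M * (A * B) := by
        rw [← Finset.mul_sum]
        exact mul_le_mul_of_nonneg_left (sum_gain_mul_gain_le hA0 (hA ξ) (hB ξ) F)
          (by positivity)

end TransInv

/-! ### Test kernels built from the derivative of a bump. -/

namespace TransInv

open Set Filter

/-- A bump function supported well inside `(0, a₀/2)`. -/
noncomputable def bump {a₀ : ℝ} (h : 0 < a₀) : ContDiffBump (a₀ / 4) where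
  rIn := a₀ / 16
  rOut := a₀ / 8
  rIn_pos := by positivity
  rIn_lt_rOut := by linarith

/-- The derivative of the bump function, as a complex function. -/
noncomputable def dbump {a₀ : ℝ} (h : 0 < a₀) (s : ℝ) : ℂ := (deriv (bump h) s : ℝ)

/-- The tensor square of the derivative of the bump function. -/
noncomputable def dbumpProd {a₀ : ℝ} (h : 0 < a₀) (z : ℝ × ℝ) : ℂ := dbump h z.1 * dbump h z.2

section bump

variable {a₀ : ℝ} (h : 0 < a₀)

theorem contDiff_bump : ContDiff ℝ ∞ (bump h) := (bump h).contDiff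

theorem contDiff_dbump : ContDiff ℝ ∞ (dbump h) :=
  Complex.ofRealCLM.contDiff.comp (contDiff_infty_iff_deriv.1 (contDiff_bump h)).2

theorem continuous_dbump : Continuous (dbump h) := (contDiff_dbump h).continuous

theorem contDiff_dbumpProd : ContDiff ℝ ∞ (dbumpProd h) :=
  ((contDiff_dbump h).comp contDiff_fst).mul ((contDiff_dbump h).comp contDiff_snd)

theorem continuous_dbumpProd : Continuous (dbumpProd h) := (contDiff_dbumpProd h).continuous

theorem mem_of_bump_ne_zero {s : ℝ} (hs : bump h s ≠ 0) : a₀ / 8 ≤ s ∧ s ≤ 3 * a₀ / 8 := by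
  have h1 : s ∈ tsupport (bump h) := subset_tsupport _ hs
  rw [(bump h).tsupport_eq, Metric.mem_closedBall, Real.dist_eq] at h1
  have h2 : (bump h).rOut = a₀ / 8 := rfl
  rw [h2] at h1
  obtain ⟨h3, h4⟩ := abs_le.1 h1
  constructor <;> linarith

theorem abs_le_of_dbump_ne_zero {s : ℝ} (hs : dbump h s ≠ 0) : |s| ≤ 3 * a₀ / 8 := by
  have h0 : deriv (bump h) s ≠ 0 := fun h0 => hs (by simp [dbump, h0])
  have h1 : s ∈ tsupport (bump h) := support_deriv_subset h0
  rw [(bump h).tsupport_eq, Metric.mem_closedBall, Real.dist_eq] at h1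
  have h2 : (bump h).rOut = a₀ / 8 := rfl
  rw [h2] at h1
  obtain ⟨h3, h4⟩ := abs_le.1 h1
  exact abs_le.2 ⟨by linarith, by linarith⟩

theorem abs_le_of_dbumpProd_ne_zero (z : ℝ × ℝ) (hz : dbumpProd h z ≠ 0) :
    |z.1| ≤ 3 * a₀ / 8 ∧ |z.2| ≤ 3 * a₀ / 8 :=
  ⟨abs_le_of_dbump_ne_zero h (left_ne_zero_of_mul hz),
    abs_le_of_dbump_ne_zero h (right_ne_zero_of_mul hz)⟩

theorem hasCompactSupport_dbump : HasCompactSupport (dbump h) :=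
  HasCompactSupport.of_support_subset_isCompact
    (isCompact_Icc (a := -(3 * a₀ / 8)) (b := 3 * a₀ / 8))
    fun _ hs => abs_le.1 (abs_le_of_dbump_ne_zero h hs)

theorem hasCompactSupport_dbumpProd : HasCompactSupport (dbumpProd h) :=
  hasCompactSupport_of_square (abs_le_of_dbumpProd_ne_zero h)

theorem hasDerivAt_bump (s : ℝ) : HasDerivAt (fun s => ((bump h s : ℝ) : ℂ)) (dbump h s) s :=
  (((contDiff_bump h).differentiable (by simp) s).hasDerivAt).ofReal_comp

theorem continuous_ofReal_bump : Continuous fun s => ((bump h s : ℝ) : ℂ) :=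
  Complex.continuous_ofReal.comp (contDiff_bump h).continuous

theorem hasCompactSupport_ofReal_bump : HasCompactSupport fun s => ((bump h s : ℝ) : ℂ) :=
  (bump h).hasCompactSupport.comp_left Complex.ofReal_zero

theorem integral_dbump : ∫ s, dbump h s = 0 :=
  integral_eq_zero_of_hasDerivAt_of_integrable (hasDerivAt_bump h)
    ((continuous_dbump h).integrable_of_hasCompactSupport (hasCompactSupport_dbump h))
    ((continuous_ofReal_bump h).integrable_of_hasCompactSupport (hasCompactSupport_ofReal_bump h))

/-- Integration by parts gives -n ∫ s^(n-1) bump(s) ds, and the bump is nonnegative and supported in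
s > 0. -/
theorem integral_pow_mul_dbump_ne_zero (n : ℕ) (hn : n ≠ 0) :
    ∫ s : ℝ, (s : ℂ) ^ n * dbump h s ≠ 0 := by
  obtain ⟨m, rfl⟩ := Nat.exists_eq_succ_of_ne_zero hn
  have hder : ∀ s : ℝ, HasDerivAt (fun s : ℝ => (s : ℂ) ^ (m + 1))
      (((m + 1 : ℕ) : ℂ) * (s : ℂ) ^ m) s := fun s => by
    simpa using ((hasDerivAt_id' s).ofReal_comp).fun_pow (m + 1)
  have hbc := continuous_ofReal_bump h
  have hbs := hasCompactSupport_ofReal_bump h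
  have hdc := continuous_dbump h
  rw [Nat.succ_eq_add_one, integral_mul_deriv_eq_deriv_mul_of_integrable
    (u := fun s : ℝ => (s : ℂ) ^ (m + 1)) (fun s _ => hder s) (fun s _ => hasDerivAt_bump h s)
    (Continuous.integrable_of_hasCompactSupport (by fun_prop)
      (hasCompactSupport_dbump h).mul_left)
    (Continuous.integrable_of_hasCompactSupport (by fun_prop) hbs.mul_left)
    (Continuous.integrable_of_hasCompactSupport (by fun_prop) hbs.mul_left)]
  have hb := (contDiff_bump h).continuous
  have hpos : 0 < ∫ s : ℝ, ((m + 1 : ℕ) : ℝ) * s ^ m * bump h s := by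
    refine Continuous.integral_pos_of_hasCompactSupport_nonneg_nonzero (x := a₀ / 4)
      (by fun_prop) (bump h).hasCompactSupport.mul_left ?_ ?_
    · intro s
      by_cases hs : bump h s = 0
      · simp [hs]
      · have h1 := (mem_of_bump_ne_zero h hs).1
        have h2 : 0 ≤ s := by linarith
        have h3 : 0 ≤ bump h s := (bump h).nonneg
        simp only [Pi.zero_apply]
        positivity
    · have h1 : bump h (a₀ / 4) = 1 := (bump h).one_of_mem_closedBall
        (Metric.mem_closedBall_self (bump h).rIn_pos.le)
      rw [h1]
      positivity
  have heq : ∫ s : ℝ, ((m + 1 : ℕ) : ℂ) * (s : ℂ) ^ m * ((bump h s : ℝ) : ℂ) =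
      ((∫ s : ℝ, ((m + 1 : ℕ) : ℝ) * s ^ m * bump h s : ℝ) : ℂ) := by
    rw [← integral_complex_ofReal]
    congr 1 with s
    push_cast
    ring
  rw [heq, neg_ne_zero]
  exact_mod_cast hpos.ne'

theorem integral_dbumpProd_mul_mul (u v : ℝ → ℂ) :
    ∫ z : ℝ × ℝ, dbumpProd h z * (u z.1 * v z.2) =
      (∫ s, u s * dbump h s) * ∫ t, v t * dbump h t := by
  rw [Measure.volume_eq_prod, ← integral_prod_mul]
  congr 1 with z
  unfold dbumpProd
  ring

theorem integral_dbumpProd_mul_fst (u : ℝ → ℂ) :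
    ∫ z : ℝ × ℝ, dbumpProd h z * u z.1 = 0 := by
  have := integral_dbumpProd_mul_mul h u 1
  simpa [integral_dbump] using this

theorem integral_dbumpProd_mul_snd (u : ℝ → ℂ) :
    ∫ z : ℝ × ℝ, dbumpProd h z * u z.2 = 0 := by
  have := integral_dbumpProd_mul_mul h 1 u
  simpa [integral_dbump] using this

theorem isKernelFamily_dbumpProd {ε : ℕ × ℕ → ℂ} {E : ℝ} (hε : ∀ j, ‖ε j‖ ≤ E) :
    IsKernelFamily a₀ fun j z => ε j * dbumpProd h z where
  smooth j := contDiff_const.mul (contDiff_dbumpProd h)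
  supp := ⟨3 * a₀ / 4, by positivity, by linarith, fun j z hz => by
    obtain ⟨h1, h2⟩ := abs_le_of_dbumpProd_ne_zero h z (right_ne_zero_of_mul hz)
    have h3 := sq_le_sq' (neg_le_of_abs_le h1) (le_of_abs_le h1)
    have h4 := sq_le_sq' (neg_le_of_abs_le h2) (le_of_abs_le h2)
    nlinarith [sq_nonneg a₀]⟩
  bounded n := by
    obtain ⟨C, hC⟩ := ((hasCompactSupport_dbumpProd h).iteratedFDeriv (𝕜 := ℝ)
      n).exists_bound_of_continuous
      ((contDiff_dbumpProd h).continuous_iteratedFDeriv (by exact_mod_cast le_top))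
    refine ⟨E * C, fun j z => ?_⟩
    have hs : (fun z => ε j * dbumpProd h z) = ε j • dbumpProd h := rfl
    rw [hs, iteratedFDeriv_const_smul_apply
      ((contDiff_dbumpProd h).of_le (by exact_mod_cast le_top)).contDiffAt, norm_smul]
    exact mul_le_mul (hε j) (hC z) (norm_nonneg _) ((norm_nonneg _).trans (hε j))
  cancel_fst j _ t := by
    simp only [dbumpProd, integral_const_mul, integral_mul_const, integral_dbump, zero_mul,
      mul_zero]
  cancel_snd j _ s := by
    simp only [dbumpProd, integral_const_mul, integral_dbump, mul_zero]

theorem exists_isAmplitude_dbumpProd :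
    ∃ M, IsAmplitude (3 * a₀ / 8) M (dbumpProd h) := by
  obtain ⟨C₀, hC₀⟩ := (hasCompactSupport_dbumpProd h).exists_bound_of_continuous
    (continuous_dbumpProd h)
  obtain ⟨C₁, hC₁⟩ := ((hasCompactSupport_dbumpProd h).fderiv
    (𝕜 := ℝ)).exists_bound_of_continuous ((contDiff_dbumpProd h).continuous_fderiv (by simp))
  exact ⟨max C₀ C₁, (contDiff_dbumpProd h).of_le (by simp), abs_le_of_dbumpProd_ne_zero h,
    fun z => le_max_of_le_left (hC₀ z), fun z => le_max_of_le_right (hC₁ z)⟩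

end bump

/-- The mean value inequality twice: for the derivative of φ in the t direction, then for φ(·, t) -
φ(·, 0). -/
theorem norm_mixed_difference_le {φ : ℝ × ℝ → ℂ} (hφ : ContDiff ℝ 2 φ) {M : ℝ}
    (hM : ∀ z : ℝ × ℝ, ‖z‖ ≤ 1 → ‖iteratedFDeriv ℝ 2 φ z‖ ≤ M) {s t : ℝ} (hs : |s| ≤ 1)
    (ht : |t| ≤ 1) :
    ‖φ (s, t) - φ (s, 0) - (φ (0, t) - φ (0, 0))‖ ≤ M * |s| * |t| := by
  have hmem : ∀ {x y : ℝ}, |x| ≤ 1 → |y| ≤ 1 → ((x, y) : ℝ × ℝ) ∈ Metric.closedBall 0 1 := by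
    intro x y hx hy
    rw [mem_closedBall_zero_iff, Prod.norm_def]
    exact max_le hx hy
  have hd : ContDiff ℝ 1 (fderiv ℝ φ) := hφ.fderiv_right (by norm_num)
  have hd1 : ∀ x : ℝ, |x| ≤ 1 → ‖fderiv ℝ φ (x, t) - fderiv ℝ φ (x, 0)‖ ≤ M * |t| := by
    intro x hx
    have := (convex_closedBall (0 : ℝ × ℝ) 1).norm_image_sub_le_of_norm_fderiv_le (𝕜 := ℝ)
      (f := fderiv ℝ φ) (C := M) (fun z _ => hd.differentiable one_ne_zero z)
      (fun z hz => by
        rw [← norm_iteratedFDeriv_one, norm_iteratedFDeriv_fderiv]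
        exact hM z (mem_closedBall_zero_iff.1 hz))
      (hmem hx (show |(0 : ℝ)| ≤ 1 by simp)) (hmem hx ht)
    refine this.trans_eq ?_
    rw [Prod.mk_sub_mk, sub_self, sub_zero, Prod.norm_def]
    simp
  have hl : ∀ x y : ℝ, HasDerivAt (fun x : ℝ => φ (x, y)) (fderiv ℝ φ (x, y) (1, 0)) x := by
    intro x y
    have hl : HasDerivAt (fun x : ℝ => ((x, y) : ℝ × ℝ)) (1, 0) x :=
      (hasDerivAt_id' x).prodMk (hasDerivAt_const x y)
    exact (hφ.differentiable two_ne_zero (x, y)).hasFDerivAt.comp_hasDerivAt x hl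
  have := (convex_closedBall (0 : ℝ) 1).norm_image_sub_le_of_norm_hasDerivWithin_le
    (f := fun x => φ (x, t) - φ (x, 0)) (C := M * |t|)
    (fun x _ => ((hl x t).sub (hl x 0)).hasDerivWithinAt)
    (fun x hx => by
      rw [← sub_apply]
      refine (ContinuousLinearMap.le_opNorm _ _).trans ?_
      rw [Prod.norm_def]
      simpa using hd1 x (mem_closedBall_zero_iff.1 hx))
    (Metric.mem_closedBall_self zero_le_one) (mem_closedBall_zero_iff.2 hs)
  refine this.trans_eq ?_
  rw [sub_zero, Real.norm_eq_abs]
  ring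

section pairing

variable {a₀ : ℝ} (h : 0 < a₀)

/-- Smooth functions are paired with the dilates of the kernel in a summable way. -/
theorem norm_integral_dilate_dbumpProd_le (ha₀ : a₀ ≤ 1) {B : ℝ} (hB : ∀ z, ‖dbumpProd h z‖ ≤ B)
    {φ : ℝ × ℝ → ℂ} (hφ : ContDiff ℝ 2 φ) {M : ℝ}
    (hM : ∀ z : ℝ × ℝ, ‖z‖ ≤ 1 → ‖iteratedFDeriv ℝ 2 φ z‖ ≤ M) (j : ℕ × ℕ) :
    ‖∫ z, dilate j (dbumpProd h) z * φ z‖ ≤ 4 * (B * M) * ((1 / 2) ^ j.1 * (1 / 2) ^ j.2) := by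
  have hφc := hφ.continuous
  have hςc := continuous_dbumpProd h
  have hςs := hasCompactSupport_dbumpProd h
  rw [integral_dilate_mul j hςc ⟨_, abs_le_of_dbumpProd_ne_zero h⟩ hφc]
  set x : ℝ := (2 ^ j.1)⁻¹ with hx
  set y : ℝ := (2 ^ j.2)⁻¹ with hy
  have hx0 : 0 ≤ x := by positivity
  have hy0 : 0 ≤ y := by positivity
  have hx1 : x ≤ 1 := inv_le_one_of_one_le₀ (one_le_pow₀ one_le_two)
  have hy1 : y ≤ 1 := inv_le_one_of_one_le₀ (one_le_pow₀ one_le_two)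
  have hint : ∀ {g : ℝ × ℝ → ℂ}, Continuous g → Integrable fun z => dbumpProd h z * g z :=
    fun hg => (hςc.mul hg).integrable_of_hasCompactSupport hςs.mul_right
  -- Functions of one variable alone integrate to zero against `dbumpProd`, so φ may be replaced by
  -- its mixed second difference, of size xy.
  have heq : ∫ z : ℝ × ℝ, dbumpProd h z * φ (x * z.1, y * z.2) = ∫ z : ℝ × ℝ, dbumpProd h z *
      (φ (x * z.1, y * z.2) - φ (x * z.1, 0) - (φ (0, y * z.2) - φ (0, 0))) := by
    have h1 : ∫ z : ℝ × ℝ, dbumpProd h z * φ (x * z.1, 0) = 0 :=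
      integral_dbumpProd_mul_fst h fun s => φ (x * s, 0)
    have h2 : ∫ z : ℝ × ℝ, dbumpProd h z * φ (0, y * z.2) = 0 :=
      integral_dbumpProd_mul_snd h fun s => φ (0, y * s)
    have h3 : ∫ z : ℝ × ℝ, dbumpProd h z * φ (0, 0) = 0 :=
      integral_dbumpProd_mul_snd h fun _ => φ (0, 0)
    simp only [mul_sub]
    rw [integral_sub, integral_sub, integral_sub, h1, h2, h3, sub_zero, sub_zero, sub_zero]
    · exact hint (by fun_prop)
    · exact hint (by fun_prop)
    · exact hint (by fun_prop)
    · exact hint (by fun_prop)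
    · exact (hint (by fun_prop)).sub (hint (by fun_prop))
    · exact (hint (by fun_prop)).sub (hint (by fun_prop))
  have hM0 : 0 ≤ M := (norm_nonneg _).trans (hM 0 (by simp))
  have hB0 : 0 ≤ B := (norm_nonneg _).trans (hB 0)
  rw [heq]
  have : ‖∫ z : ℝ × ℝ, dbumpProd h z *
      (φ (x * z.1, y * z.2) - φ (x * z.1, 0) - (φ (0, y * z.2) - φ (0, 0)))‖
      ≤ 4 * (B * (M * x * y)) := by
    refine norm_integral_le_of_square (r := 3 * a₀ / 8) (by linarith)
      (fun z hz => abs_le_of_dbumpProd_ne_zero h z (left_ne_zero_of_mul hz)) fun z => ?_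
    by_cases hz : dbumpProd h z = 0
    · rw [hz, zero_mul, norm_zero]
      positivity
    obtain ⟨h1, h2⟩ := abs_le_of_dbumpProd_ne_zero h z hz
    have h1' : |x * z.1| ≤ x := by
      rw [abs_mul, abs_of_nonneg hx0]
      exact mul_le_of_le_one_right hx0 (by linarith)
    have h2' : |y * z.2| ≤ y := by
      rw [abs_mul, abs_of_nonneg hy0]
      exact mul_le_of_le_one_right hy0 (by linarith)
    rw [norm_mul]
    refine mul_le_mul (hB z) ((norm_mixed_difference_le hφ hM (h1'.trans hx1)
      (h2'.trans hy1)).trans ?_) (norm_nonneg _) hB0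
    gcongr
  refine this.trans_eq ?_
  rw [hx, hy, one_div, inv_pow, inv_pow]
  ring

theorem summable_half_mul_half :
    Summable fun j : ℕ × ℕ => (1 / 2 : ℝ) ^ j.1 * (1 / 2) ^ j.2 :=
  summable_geometric_two.mul_of_nonneg summable_geometric_two (fun _ => by positivity)
    fun _ => by positivity

theorem dilate_const_mul (j : ℕ × ℕ) (c : ℂ) (g : ℝ × ℝ → ℂ) (z : ℝ × ℝ) :
    dilate j (fun z => c * g z) z = c * dilate j g z := by
  unfold dilate; ring

/-- The product kernel with coefficients `ε`. -/
theorem exists_distribution (ha₀ : a₀ ≤ 1) {ε : ℕ × ℕ → ℂ} {E : ℝ} (hε : ∀ j, ‖ε j‖ ≤ E) :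
    ∃ K : 𝓓'((⊤ : Opens (ℝ × ℝ)), ℂ), ∀ φ : 𝓓((⊤ : Opens (ℝ × ℝ)), ℝ),
      HasSum (fun j : ℕ × ℕ => ∫ z : ℝ × ℝ,
        (φ z : ℂ) * dilate j (fun z => ε j * dbumpProd h z) z) (K φ) := by
  obtain ⟨B, hamp⟩ := exists_isAmplitude_dbumpProd h
  have hB := hamp.bound
  have hE : 0 ≤ E := (norm_nonneg _).trans (hε 0)
  have hB0 : 0 ≤ B := hamp.nonneg
  set I : (ℝ × ℝ → ℝ) → ℕ × ℕ → ℂ := fun φ j => ∫ z : ℝ × ℝ,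
    (φ z : ℂ) * dilate j (fun z => ε j * dbumpProd h z) z with hI
  have hbound : ∀ {φ : ℝ × ℝ → ℝ}, ContDiff ℝ 2 φ → ∀ {M : ℝ},
      (∀ z : ℝ × ℝ, ‖iteratedFDeriv ℝ 2 φ z‖ ≤ M) → ∀ j, ‖I φ j‖ ≤
        E * (4 * (B * M)) * ((1 / 2) ^ j.1 * (1 / 2) ^ j.2) := by
    intro φ hφ M hM j
    have h1 : I φ j = ε j * ∫ z, dilate j (dbumpProd h) z * (φ z : ℂ) := by
      simp only [hI]
      rw [← integral_const_mul]
      congr 1 with z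
      rw [dilate_const_mul]
      ring
    have h2 : ContDiff ℝ 2 fun z => (φ z : ℂ) := Complex.ofRealCLM.contDiff.comp hφ
    have h3 : ∀ z, ‖iteratedFDeriv ℝ 2 (fun z => (φ z : ℂ)) z‖ ≤ M := fun z => by
      have := Complex.ofRealLI.norm_iteratedFDeriv_comp_left (hφ.contDiffAt (x := z)) (i := 2)
        le_rfl
      exact this.trans_le (hM z)
    rw [h1, norm_mul, mul_assoc]
    exact mul_le_mul (hε j) (norm_integral_dilate_dbumpProd_le h ha₀ hB h2 (fun z _ => h3 z) j)
      (norm_nonneg _) hE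
  have hC2 : ∀ φ : 𝓓((⊤ : Opens (ℝ × ℝ)), ℝ), ContDiff ℝ 2 φ := fun φ =>
    φ.contDiff.of_le (WithTop.coe_le_coe.2 le_top)
  have hsum : ∀ φ : 𝓓((⊤ : Opens (ℝ × ℝ)), ℝ), Summable (I φ) := by
    intro φ
    obtain ⟨M, hM⟩ := (φ.hasCompactSupport.iteratedFDeriv (𝕜 := ℝ) 2).exists_bound_of_continuous
      ((hC2 φ).continuous_iteratedFDeriv le_rfl)
    exact Summable.of_norm_bounded (summable_half_mul_half.mul_left _) (hbound (hC2 φ) hM)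
  have hint : ∀ (φ : 𝓓((⊤ : Opens (ℝ × ℝ)), ℝ)) j, Integrable fun z => (φ z : ℂ) *
      dilate j (fun z => ε j * dbumpProd h z) z := fun φ j =>
    ((Complex.continuous_ofReal.comp φ.continuous).mul (continuous_dilate j
      (continuous_const.mul (continuous_dbumpProd h)))).integrable_of_hasCompactSupport
      (φ.hasCompactSupport.comp_left Complex.ofReal_zero).mul_right
  have hadd : ∀ φ φ' : 𝓓((⊤ : Opens (ℝ × ℝ)), ℝ), I (φ + φ' : 𝓓((⊤ : Opens (ℝ × ℝ)), ℝ)) =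
      I φ + I φ' := by
    intro φ φ'
    funext j
    simp only [Pi.add_apply, hI]
    rw [← integral_add (hint φ j) (hint φ' j)]
    congr 1 with z
    rw [add_apply]
    push_cast
    ring
  have hsmul : ∀ (c : ℝ) (φ : 𝓓((⊤ : Opens (ℝ × ℝ)), ℝ)),
      I (c • φ : 𝓓((⊤ : Opens (ℝ × ℝ)), ℝ)) = c • I φ := by
    intro c φ
    funext j
    simp only [Pi.smul_apply, hI]
    rw [← integral_smul]
    congr 1 with z
    rw [smul_apply, smul_eq_mul, Complex.real_smul]
    push_cast
    ring
  set T : ℝ := ∑' j : ℕ × ℕ, (1 / 2 : ℝ) ^ j.1 * (1 / 2) ^ j.2 with hT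
  have hT0 : 0 ≤ T := tsum_nonneg fun _ => by positivity
  -- Continuity is checked on test functions with support in a fixed compact set, where the seminorm
  -- of order 2 dominates the series.
  refine ⟨TestFunction.limitCLM ℝ (fun φ => ∑' j, I φ j)
    (fun Q hQ => ContDiffMapSupportedIn.mkCLMtoNormedSpace ℝ
      (fun φ => ∑' j, I (TestFunction.ofSupportedIn hQ φ) j)
      (fun φ φ' => ?_) (fun c φ => ?_) ⟨{2}, E * (4 * B) * T, by positivity, fun φ => ?_⟩)
    (fun Q hQ φ => rfl), fun φ => (hsum φ).hasSum⟩
  · have : TestFunction.ofSupportedIn hQ (φ + φ') = TestFunction.ofSupportedIn hQ φ +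
        TestFunction.ofSupportedIn hQ φ' := rfl
    rw [this, hadd]
    exact (hsum _).tsum_add (hsum _)
  · have : TestFunction.ofSupportedIn hQ (c • φ) = c • TestFunction.ofSupportedIn hQ φ := rfl
    rw [this, hsmul]
    exact (hsum _).tsum_const_smul c
  · rw [Finset.sup_singleton]
    have hM : ∀ z, ‖iteratedFDeriv ℝ 2 (TestFunction.ofSupportedIn hQ φ) z‖ ≤
        ContDiffMapSupportedIn.seminorm ℝ (ℝ × ℝ) ℝ ⊤ Q 2 φ := fun z =>
      ContDiffMapSupportedIn.norm_iteratedFDeriv_apply_le_seminorm_top ℝ (f := φ)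
    have hle := tsum_of_norm_bounded (summable_half_mul_half.hasSum.mul_left _)
      (hbound (hC2 (TestFunction.ofSupportedIn hQ φ)) hM)
    rw [← hT] at hle
    linarith

end pairing

end TransInv

/-! ### The vertex below the line, its scales, and bounds for the multiplier. -/

namespace TransInv

open Set Filter

/-- An interior vertex of the Newton polygon below the line, with strictly positive integral
weights singling it out. -/
theorem exists_strict_vertex {S : Finset (ℕ × ℕ)} {a b : ℕ} (ha : 0 < a)
    (hSa : ∀ n, (n, 0) ∈ S → a ≤ n) (hSb : ∀ n, (0, n) ∈ S → b ≤ n) {e : ℕ × ℕ} (he : e ∈ S)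
    (hlt : b * e.1 + a * e.2 < a * b) :
    ∃ α β : ℕ, 0 < α ∧ 0 < β ∧ ∃ e₀ ∈ S, 0 < e₀.1 ∧ 0 < e₀.2 ∧
      ∀ e ∈ S, e ≠ e₀ → α * e₀.1 + β * e₀.2 < α * e.1 + β * e.2 := by
  obtain ⟨M, hM⟩ : ∃ M : ℕ, ∀ e ∈ S, e.1 < M := by
    refine ⟨S.sup Prod.fst + 1, fun e he => Nat.lt_succ_of_le (Finset.le_sup (f := Prod.fst) he)⟩
  have hM0 : 0 < M := (Nat.zero_le _).trans_lt (hM e he)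
  -- Since M exceeds every e.1, w orders S lexicographically: first by b e.1 + a e.2, then by e.1.
  -- Its minimiser is therefore unique and strictly below the line, whereas points of S on the axes
  -- are on or above it.
  set w : ℕ × ℕ → ℕ := fun e => M * (b * e.1 + a * e.2) + e.1 with hw
  obtain ⟨e₀, he₀, hmin⟩ := S.exists_min_image w ⟨e, he⟩
  have hwe : ∀ e : ℕ × ℕ, (M * b + 1) * e.1 + M * a * e.2 = w e := fun e => by
    simp only [hw]; ring
  have hx₀ : b * e₀.1 + a * e₀.2 < a * b := by
    have h1 := hmin e he
    simp only [hw] at h1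
    have h2 := hM e he
    have h3 : M * (b * e.1 + a * e.2 + 1) ≤ M * (a * b) := Nat.mul_le_mul_left _ hlt
    have h4 : M * (b * e₀.1 + a * e₀.2) < M * (a * b) := by linarith
    exact Nat.lt_of_mul_lt_mul_left h4
  refine ⟨M * b + 1, M * a, Nat.succ_pos _, Nat.mul_pos hM0 ha, e₀, he₀, ?_, ?_, ?_⟩
  · by_contra h0
    have h0' : e₀.1 = 0 := by omega
    have h1 : (0, e₀.2) ∈ S := by rwa [← h0']
    have h2 := Nat.mul_le_mul_left a (hSb _ h1)
    rw [h0'] at hx₀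
    omega
  · by_contra h0
    have h0' : e₀.2 = 0 := by omega
    have h1 : (e₀.1, 0) ∈ S := by rwa [← h0']
    have h2 := Nat.mul_le_mul_left b (hSa _ h1)
    rw [h0', mul_comm a b] at hx₀
    omega
  · intro e' he' hne
    rw [hwe, hwe]
    refine lt_of_le_of_ne (hmin e' he') fun heq => hne ?_
    simp only [hw] at heq
    have h1 := hM e' he'
    have h2 := hM e₀ he₀
    have hx : b * e₀.1 + a * e₀.2 = b * e'.1 + a * e'.2 := by
      rcases lt_trichotomy (b * e₀.1 + a * e₀.2) (b * e'.1 + a * e'.2) with h | h | h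
      · have : M * (b * e₀.1 + a * e₀.2 + 1) ≤ M * (b * e'.1 + a * e'.2) :=
          Nat.mul_le_mul_left _ h
        linarith
      · exact h
      · have : M * (b * e'.1 + a * e'.2 + 1) ≤ M * (b * e₀.1 + a * e₀.2) :=
          Nat.mul_le_mul_left _ h
        linarith
    rw [hx] at heq
    have h3 : e'.1 = e₀.1 := by omega
    rw [h3] at hx
    have h4 : a * e₀.2 = a * e'.2 := by omega
    exact Prod.ext h3 (Nat.eq_of_mul_eq_mul_left ha h4).symm

/-- There are arbitrarily many scales at which the vertex monomial dominates and has the same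
size. -/
theorem exists_scales {S : Finset (ℕ × ℕ)} {α β : ℕ} (hβ : 0 < β) {e₀ : ℕ × ℕ}
    (h2 : 0 < e₀.2)
    (hmin : ∀ e ∈ S, e ≠ e₀ → α * e₀.1 + β * e₀.2 < α * e.1 + β * e.2) (N : ℕ) :
    ∃ (L : ℕ) (F : Finset (ℕ × ℕ)), F.card = N ∧ ∀ j ∈ F, e₀.1 * j.1 + e₀.2 * j.2 = L ∧
      ∀ e ∈ S, e ≠ e₀ → L + N ≤ e.1 * j.1 + e.2 * j.2 := by
  obtain ⟨D, hD⟩ : ∃ D : ℕ, ∀ e ∈ S, e.2 ≤ D :=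
    ⟨S.sup Prod.snd, fun e he => Finset.le_sup (f := Prod.snd) he⟩
  -- R N ≥ N + N e₀.1 D lets the strict gap of the weights absorb the shifts below and still leave
  -- N. Also R ≥ e₀.1, so the subtraction in `J` is never truncated.
  set R := 1 + e₀.1 * (D + 1) with hR
  have hsub : ∀ k < N, ∃ m, m + k * e₀.1 = R * N * β := by
    intro k hk
    refine ⟨R * N * β - k * e₀.1, Nat.sub_add_cancel ?_⟩
    calc k * e₀.1 ≤ N * e₀.1 := Nat.mul_le_mul_right _ hk.le
      _ ≤ N * R := Nat.mul_le_mul_left _ (by rw [hR]; nlinarith)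
      _ = R * N * 1 := by ring
      _ ≤ _ := Nat.mul_le_mul_left _ hβ
  -- Multiples of the weight vector, shifted along the direction (e₀.2, -e₀.1), which leaves e₀·j
  -- unchanged.
  set J : ℕ → ℕ × ℕ := fun k => (R * N * α + k * e₀.2, R * N * β - k * e₀.1) with hJ
  have hJinj : Function.Injective J := fun k k' hkk' => by
    have := congrArg Prod.fst hkk'
    simp only [hJ, add_right_inj] at this
    exact Nat.eq_of_mul_eq_mul_right h2 this
  refine ⟨R * N * (α * e₀.1 + β * e₀.2), (Finset.range N).image J, ?_, ?_⟩
  · rw [Finset.card_image_of_injective _ hJinj, Finset.card_range]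
  · intro j hj
    obtain ⟨k, hk, rfl⟩ := Finset.mem_image.1 hj
    have hkN := Finset.mem_range.1 hk
    obtain ⟨m, hm⟩ := hsub k hkN
    have hJ2 : (J k).2 = m := by simp only [hJ]; omega
    have hJ1 : (J k).1 = R * N * α + k * e₀.2 := rfl
    rw [hJ1, hJ2]
    refine ⟨?_, fun e he hne => ?_⟩
    · calc e₀.1 * (R * N * α + k * e₀.2) + e₀.2 * m
          = R * N * (α * e₀.1) + e₀.2 * (m + k * e₀.1) := by ring
        _ = _ := by rw [hm]; ring
    · have h3 := Nat.mul_le_mul_left (R * N) (Nat.succ_le_of_lt (hmin e he hne))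
      have h4 : k * e₀.1 * e.2 ≤ N * e₀.1 * D :=
        Nat.mul_le_mul (Nat.mul_le_mul_right _ hkN.le) (hD e he)
      have h5 : N + N * e₀.1 * D ≤ R * N := by rw [hR]; nlinarith [Nat.zero_le (N * e₀.1)]
      have h6 : e.1 * (R * N * α + k * e₀.2) + e.2 * m + k * e₀.1 * e.2 =
          R * N * (α * e.1 + β * e.2) + k * e₀.2 * e.1 := by
        calc _ = R * N * (α * e.1) + k * e₀.2 * e.1 + e.2 * (m + k * e₀.1) := by ring
          _ = _ := by rw [hm]; ring
      have h7 : R * N * (α * e₀.1 + β * e₀.2).succ =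
          R * N * (α * e₀.1 + β * e₀.2) + R * N := by rw [Nat.mul_succ]
      rw [h7] at h3
      have h8 := Nat.zero_le (k * e₀.2 * e.1)
      linarith

/-- At frequency μ 2^L the vertex monomial has coefficient μ c(e₀) exactly, while each other
monomial loses a factor 2^(-N). -/
theorem norm_osc_sub_osc_le {S : Finset (ℕ × ℕ)} (c : ℕ × ℕ → ℝ) {e₀ : ℕ × ℕ} (he₀ : e₀ ∈ S)
    {L N : ℕ} {j : ℕ × ℕ} (hL : e₀.1 * j.1 + e₀.2 * j.2 = L)
    (hN : ∀ e ∈ S, e ≠ e₀ → L + N ≤ e.1 * j.1 + e.2 * j.2) (μ : ℝ) {r M : ℝ} (hr : r ≤ 1)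
    {ψ : ℝ × ℝ → ℂ} (hψ : IsAmplitude r M ψ) :
    ‖osc S c (2 ^ j.1)⁻¹ (2 ^ j.2)⁻¹ (μ * 2 ^ L) ψ - osc {e₀} c 1 1 μ ψ‖ ≤
      4 * (M * (|μ| * (∑ e ∈ S, |c e|) * (1 / 2) ^ N)) := by
  have hM := hψ.nonneg
  set A := ∑ e ∈ S, |c e| with hA
  have hA0 : 0 ≤ A := Finset.sum_nonneg fun _ _ => abs_nonneg _
  unfold osc
  rw [← integral_sub (hψ.integrable_mul (by unfold monoSum; fun_prop))
    (hψ.integrable_mul (by unfold monoSum; fun_prop))]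
  simp only [← mul_sub]
  refine norm_integral_le_of_square hr (fun z hz => hψ.supp z (left_ne_zero_of_mul hz))
    fun z => ?_
  by_cases hz : ψ z = 0
  · rw [hz, zero_mul, norm_zero]
    positivity
  obtain ⟨hz1, hz2⟩ := hψ.supp z hz
  replace hz1 := hz1.trans hr
  replace hz2 := hz2.trans hr
  rw [norm_mul]
  refine mul_le_mul (hψ.bound z) ((norm_exp_sub_exp_le _ _).trans ?_) (norm_nonneg _) hM
  have hterm : ∀ e : ℕ × ℕ, ((2 : ℝ) ^ j.1)⁻¹ ^ e.1 * (2 ^ j.2)⁻¹ ^ e.2 =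
      (2 ^ (e.1 * j.1 + e.2 * j.2))⁻¹ := fun e => by
    rw [inv_pow, inv_pow, ← mul_inv, ← pow_mul, ← pow_mul, ← pow_add, mul_comm j.1, mul_comm j.2]
  have hdiff : μ * 2 ^ L * monoSum S c ((2 ^ j.1)⁻¹ * z.1) ((2 ^ j.2)⁻¹ * z.2) -
      μ * monoSum {e₀} c (1 * z.1) (1 * z.2) = ∑ e ∈ S.erase e₀,
        c e * (μ * (2 ^ L * (2 ^ (e.1 * j.1 + e.2 * j.2))⁻¹) * (z.1 ^ e.1 * z.2 ^ e.2)) := by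
    unfold monoSum
    rw [← Finset.add_sum_erase _ _ he₀, Finset.sum_singleton, mul_add, Finset.mul_sum, one_mul,
      one_mul]
    have h1 : μ * 2 ^ L * (c e₀ * (((2 ^ j.1)⁻¹ * z.1) ^ e₀.1 * ((2 ^ j.2)⁻¹ * z.2) ^ e₀.2)) =
        μ * (c e₀ * (z.1 ^ e₀.1 * z.2 ^ e₀.2)) := by
      have h2 := hterm e₀
      rw [hL] at h2
      calc _ = μ * c e₀ * (z.1 ^ e₀.1 * z.2 ^ e₀.2) *
            (2 ^ L * (((2 : ℝ) ^ j.1)⁻¹ ^ e₀.1 * (2 ^ j.2)⁻¹ ^ e₀.2)) := by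
            rw [mul_pow, mul_pow]; ring
        _ = _ := by
            rw [h2, mul_inv_cancel₀ (by positivity)]
            ring
    rw [h1, add_sub_cancel_left]
    refine Finset.sum_congr rfl fun e _ => ?_
    rw [← hterm, mul_pow, mul_pow]
    ring
  rw [hdiff]
  refine (Finset.abs_sum_le_sum_abs _ _).trans ?_
  calc _ ≤ ∑ e ∈ S.erase e₀, |c e| * (|μ| * (1 / 2) ^ N) := by
        refine Finset.sum_le_sum fun e he => ?_
        obtain ⟨hne, he⟩ := Finset.mem_erase.1 he
        rw [abs_mul, abs_mul, abs_mul, abs_mul (z.1 ^ _), abs_pow z.1, abs_pow z.2]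
        refine mul_le_mul_of_nonneg_left ?_ (abs_nonneg _)
        have h1 : |(2 : ℝ) ^ L * (2 ^ (e.1 * j.1 + e.2 * j.2))⁻¹| ≤ (1 / 2) ^ N := by
          rw [abs_of_nonneg (by positivity), one_div, inv_pow, ← div_eq_mul_inv,
            div_le_iff₀ (by positivity), ← div_eq_inv_mul, le_div_iff₀ (by positivity), ← pow_add]
          exact pow_le_pow_right₀ one_le_two (hN e he hne)
        have h2 : |z.1| ^ e.1 * |z.2| ^ e.2 ≤ 1 :=
          mul_le_one₀ (pow_le_one₀ (abs_nonneg _) hz1) (by positivity)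
            (pow_le_one₀ (abs_nonneg _) hz2)
        calc _ ≤ |μ| * (1 / 2) ^ N * 1 := by gcongr
          _ = _ := mul_one _
    _ ≤ ∑ e ∈ S, |c e| * (|μ| * (1 / 2) ^ N) :=
        Finset.sum_le_sum_of_subset_of_nonneg (Finset.erase_subset _ _)
          fun _ _ _ => by positivity
    _ = _ := by rw [← Finset.sum_mul, hA]; ring

/-- Expansion in a small frequency: the constant term vanishes by cancellation, and the linear term
is a product of two nonzero moments, because both exponents are positive. -/
theorem exists_osc_dbumpProd_ne_zero {a₀ : ℝ} (h : 0 < a₀) (ha₀ : a₀ ≤ 1) {c : ℕ × ℕ → ℝ}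
    {e : ℕ × ℕ} (hc : c e ≠ 0) (h1 : 0 < e.1) (h2 : 0 < e.2) :
    ∃ μ : ℝ, osc {e} c 1 1 μ (dbumpProd h) ≠ 0 := by
  obtain ⟨M, hamp⟩ := exists_isAmplitude_dbumpProd h
  have hM := hamp.nonneg
  set J : ℂ := ∫ z : ℝ × ℝ, dbumpProd h z * ((z.1 : ℂ) ^ e.1 * (z.2 : ℂ) ^ e.2) with hJ
  have hJ0 : J ≠ 0 := by
    rw [hJ, integral_dbumpProd_mul_mul h (fun s : ℝ => (s : ℂ) ^ e.1) (fun s : ℝ => (s : ℂ) ^ e.2)]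
    exact mul_ne_zero (integral_pow_mul_dbump_ne_zero h _ h1.ne')
      (integral_pow_mul_dbump_ne_zero h _ h2.ne')
  have hJpos : 0 < ‖J‖ := norm_pos_iff.2 hJ0
  -- Small enough that the quadratic remainder 4Mν² is below the linear term ν‖J‖.
  set ν : ℝ := min 1 (‖J‖ / (8 * (M + 1))) with hν
  have hν0 : 0 < ν := lt_min one_pos (by positivity)
  have hν1 : ν ≤ 1 := min_le_left _ _
  have hνJ : 4 * (M * ν) < ‖J‖ := by
    have : ν ≤ ‖J‖ / (8 * (M + 1)) := min_le_right _ _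
    rw [le_div_iff₀ (by positivity)] at this
    nlinarith
  refine ⟨ν / c e, fun h0 => ?_⟩
  have hphase : ∀ z : ℝ × ℝ, ν / c e * monoSum {e} c (1 * z.1) (1 * z.2) =
      ν * (z.1 ^ e.1 * z.2 ^ e.2) := fun z => by
    unfold monoSum
    rw [Finset.sum_singleton, one_mul, one_mul]
    field_simp
  unfold osc at h0
  simp only [hphase] at h0
  have hz : ∫ z : ℝ × ℝ, dbumpProd h z * (1 : ℂ) = 0 :=
    integral_dbumpProd_mul_fst h fun _ => (1 : ℂ)
  have hlin : ∫ z : ℝ × ℝ, dbumpProd h z *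
      (Complex.I * (ν * (z.1 ^ e.1 * z.2 ^ e.2) : ℝ)) = Complex.I * ν * J := by
    rw [hJ, ← integral_const_mul]
    refine integral_congr_ae (Eventually.of_forall fun z => ?_)
    push_cast
    ring
  have hexp : ∫ z : ℝ × ℝ, dbumpProd h z *
      (Complex.exp (Complex.I * (ν * (z.1 ^ e.1 * z.2 ^ e.2) : ℝ)) - 1 -
        Complex.I * (ν * (z.1 ^ e.1 * z.2 ^ e.2) : ℝ)) = - (Complex.I * ν * J) := by
    simp only [mul_sub]
    rw [integral_sub, integral_sub, h0, hz, ← hlin]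
    · simp only [zero_sub, sub_zero]
    · exact hamp.integrable_mul (by fun_prop)
    · exact hamp.integrable_mul (by fun_prop)
    · exact (hamp.integrable_mul (by fun_prop)).sub (hamp.integrable_mul (by fun_prop))
    · exact hamp.integrable_mul (by fun_prop)
  have hle : ‖Complex.I * ν * J‖ ≤ 4 * (M * ν ^ 2) := by
    rw [← norm_neg, ← hexp]
    refine norm_integral_le_of_square (r := 3 * a₀ / 8) (by linarith)
      (fun z hz => hamp.supp z (left_ne_zero_of_mul hz)) fun z => ?_
    by_cases hz : dbumpProd h z = 0
    · rw [hz, zero_mul, norm_zero]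
      positivity
    obtain ⟨h3, h4⟩ := hamp.supp z hz
    have h5 : |ν * (z.1 ^ e.1 * z.2 ^ e.2)| ≤ ν := by
      rw [abs_mul, abs_of_pos hν0, abs_mul, abs_pow, abs_pow]
      refine mul_le_of_le_one_right hν0.le (mul_le_one₀ (pow_le_one₀ (abs_nonneg _) ?_)
        (by positivity) (pow_le_one₀ (abs_nonneg _) ?_)) <;> linarith
    have h6 : ‖Complex.I * (ν * (z.1 ^ e.1 * z.2 ^ e.2) : ℝ)‖ ≤ ν := by
      rw [norm_mul, Complex.norm_I, one_mul, Complex.norm_real]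
      exact h5
    rw [norm_mul]
    refine mul_le_mul (hamp.bound z) ((Complex.norm_exp_sub_one_sub_id_le
      (h6.trans hν1)).trans ?_) (norm_nonneg _) hM
    gcongr
  rw [norm_mul, norm_mul, Complex.norm_I, one_mul, Complex.norm_real, Real.norm_eq_abs,
    abs_of_pos hν0] at hle
  nlinarith

/-- The multiplier of an `L²`-bounded operator is bounded. -/
theorem exists_bound_of_isL2Bounded {p : MvPolynomial (Fin 2) ℝ}
    {K : 𝓓'((⊤ : Opens (ℝ × ℝ)), ℂ)} {a₀ : ℝ} {ς : ℕ × ℕ → ℝ × ℝ → ℂ} (ha₀ : a₀ ≤ 1)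
    (h : IsKernelFamily a₀ ς)
    (hK : ∀ φ : 𝓓((⊤ : Opens (ℝ × ℝ)), ℝ),
      HasSum (fun j : ℕ × ℕ => ∫ z : ℝ × ℝ, (φ z : ℂ) * dilate j (ς j) z) (K φ))
    (hT : IsL2Bounded (opT p K)) :
    ∃ C : ℝ, ∀ (ξ : ℝ) (m : ℂ), HasSum (fun j => ∫ z, dilate j (ς j) z *
      Complex.exp (Complex.I * (ξ * polyFun p z : ℝ))) m → ‖m‖ ≤ C := by
  obtain ⟨C, hC⟩ := hT
  obtain ⟨r, hr, hsq⟩ := h.exists_square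
  have hP : Continuous (polyFun p) := (contDiff_polyFun p).continuous
  obtain ⟨Q₀, hQ₀⟩ := (isCompact_closedBall (0 : ℝ × ℝ) 1).exists_bound_of_continuousOn
    hP.continuousOn
  set Q := max Q₀ 0 with hQ
  have hQ0 : 0 ≤ Q := le_max_right _ _
  -- |p| ≤ Q on the supports, so χ(x - p) = 1 there for |x| ≤ 1.
  let χ : ContDiffBump (0 : ℝ) := ⟨Q + 1, Q + 2, by linarith, by linarith⟩
  have hχ1 : ∀ x, |x| ≤ Q + 1 → χ x = 1 := fun x hx =>
    χ.one_of_mem_closedBall (mem_closedBall_zero_iff.2 hx)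
  set B : ℝ≥0∞ := eLpNorm (fun x => ((χ x : ℝ) : ℂ)) 2 volume with hB
  have hχc : Continuous fun x => ((χ x : ℝ) : ℂ) :=
    Complex.continuous_ofReal.comp χ.continuous
  have hχs : HasCompactSupport fun x => ((χ x : ℝ) : ℂ) :=
    χ.hasCompactSupport.comp_left Complex.ofReal_zero
  have hBtop : B ≠ ⊤ := (hχc.memLp_of_hasCompactSupport hχs).eLpNorm_lt_top.ne
  refine ⟨(C * B).toReal, fun ξ m hm => ?_⟩
  -- A truncated plane wave: its L² norm does not depend on ξ, and on [-1, 1] the operator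
  -- multiplies exp(-iξx) by m.
  let f : 𝓓((⊤ : Opens ℝ), ℂ) :=
    { toFun := fun x => ((χ x : ℝ) : ℂ) * Complex.exp (Complex.I * (-(ξ * x) : ℝ))
      contDiff' := (Complex.ofRealCLM.contDiff.comp χ.contDiff).mul
        (Complex.contDiff_exp.comp (contDiff_const.mul
          (Complex.ofRealCLM.contDiff.comp (contDiff_const.mul contDiff_id).neg)))
      hasCompactSupport' := hχs.mul_right
      tsupport_subset' := fun _ _ => trivial }
  have hf : ∀ x, f x = ((χ x : ℝ) : ℂ) * Complex.exp (Complex.I * (-(ξ * x) : ℝ)) := fun _ => rfl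
  have hfB : eLpNorm f 2 volume = B := by
    refine eLpNorm_congr_norm_ae (Eventually.of_forall fun x => ?_)
    rw [hf, norm_mul, Complex.norm_exp_I_mul_ofReal, mul_one]
  have hval : ∀ x ∈ Icc (-1 : ℝ) 1, ‖opT p K f x‖ = ‖m‖ := by
    intro x hx
    have hx1 : |x| ≤ 1 := abs_le.2 hx
    have h1 := hasSum_opT (p := p) ha₀ h hK f x
    have h2 := hm.mul_left (Complex.exp (Complex.I * (-(ξ * x) : ℝ)))
    have h3 : opT p K f x = Complex.exp (Complex.I * (-(ξ * x) : ℝ)) * m := by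
      refine h1.unique (h2.congr_fun fun j => ?_)
      rw [← integral_const_mul]
      refine integral_congr_ae (Eventually.of_forall fun z => ?_)
      by_cases hz : dilate j (ς j) z = 0
      · simp only [hz, mul_zero, zero_mul]
      obtain ⟨hz1, hz2⟩ := abs_le_of_dilate_ne_zero (hsq j) z hz
      have hPz : |polyFun p z| ≤ Q := by
        refine (hQ₀ z (mem_closedBall_zero_iff.2 ?_)).trans (le_max_left _ _)
        rw [Prod.norm_def]
        exact max_le (hz1.trans (hr.le.trans ha₀)) (hz2.trans (hr.le.trans ha₀))
      have hχx : χ (x - polyFun p z) = 1 := hχ1 _ ((abs_sub _ _).trans (by linarith))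
      simp only [hf, hχx, Complex.ofReal_one, one_mul]
      rw [mul_left_comm, ← Complex.exp_add, mul_comm]
      congr 2
      push_cast
      ring
    rw [h3, norm_mul, Complex.norm_exp_I_mul_ofReal, one_mul]
  have hlow : ‖m‖ₑ * (volume (Icc (-1 : ℝ) 1)) ^ (1 / (2 : ℝ≥0∞).toReal) ≤ C * B := by
    rw [← eLpNorm_indicator_const measurableSet_Icc two_ne_zero ENNReal.ofNat_ne_top, ← hfB]
    refine (eLpNorm_mono fun x => ?_).trans (hC f).2
    by_cases hx : x ∈ Icc (-1 : ℝ) 1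
    · rw [indicator_of_mem hx, hval x hx]
    · rw [indicator_of_notMem hx, norm_zero]
      exact norm_nonneg _
  have hvol : 1 ≤ (volume (Icc (-1 : ℝ) 1)) ^ (1 / (2 : ℝ≥0∞).toReal) := by
    refine ENNReal.one_le_rpow ?_ (by simp)
    rw [Real.volume_Icc, ← ENNReal.ofReal_one]
    exact ENNReal.ofReal_le_ofReal (by norm_num)
  have hfin : ‖m‖ₑ ≤ C * B := (le_mul_of_one_le_right zero_le hvol).trans hlow
  rw [← toReal_enorm]
  exact ENNReal.toReal_mono (ENNReal.mul_ne_top ENNReal.coe_ne_top hBtop) hfin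

end TransInv

/-! ### Uniform boundedness, necessity of the condition, and the theorem. -/

namespace TransInv

open Set Filter

/-- A consequence of the uniform boundedness principle: if a family of absolutely convergent
series stays bounded after multiplication by any bounded sequence, then the sums of absolute
values are bounded. -/
theorem exists_sum_norm_le_of_forall_bounded {ι : Type*} {m : ι → ℕ × ℕ → ℂ}
    (hm : ∀ i, Summable fun j => ‖m i j‖)
    (h : ∀ ε : ℕ × ℕ → ℂ, (∃ E, ∀ j, ‖ε j‖ ≤ E) → ∃ C, ∀ i, ‖∑' j, ε j * m i j‖ ≤ C) :
    ∃ C, ∀ i (F : Finset (ℕ × ℕ)), ∑ j ∈ F, ‖m i j‖ ≤ C := by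
  have hle : ∀ i (ε : BoundedContinuousFunction (ℕ × ℕ) ℂ) j, ‖ε j * m i j‖ ≤ ‖ε‖ * ‖m i j‖ :=
    fun i ε j => by
      rw [norm_mul]
      exact mul_le_mul_of_nonneg_right (ε.norm_coe_le_norm j) (norm_nonneg _)
  have hs : ∀ i (ε : BoundedContinuousFunction (ℕ × ℕ) ℂ), Summable fun j => ε j * m i j :=
    fun i ε => Summable.of_norm_bounded ((hm i).mul_left _) (hle i ε)
  let Λ : ι → BoundedContinuousFunction (ℕ × ℕ) ℂ →L[ℂ] ℂ := fun i =>
    LinearMap.mkContinuous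
      { toFun := fun ε => ∑' j, ε j * m i j
        map_add' := fun ε ε' => by
          simp only [BoundedContinuousFunction.add_apply, add_mul]
          exact (hs i ε).tsum_add (hs i ε')
        map_smul' := fun c ε => by
          simp only [BoundedContinuousFunction.smul_apply, smul_eq_mul, mul_assoc,
            RingHom.id_apply]
          exact tsum_mul_left }
      (∑' j, ‖m i j‖) fun ε => by
        refine (tsum_of_norm_bounded ((hm i).hasSum.mul_left ‖ε‖) (hle i ε)).trans_eq ?_
        ring
  have hΛ : ∀ i ε, Λ i ε = ∑' j, ε j * m i j := fun _ _ => rfl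
  obtain ⟨C, hC⟩ := banach_steinhaus (g := Λ) fun ε => h ε ⟨‖ε‖, ε.norm_coe_le_norm⟩
  refine ⟨C, fun i F => ?_⟩
  -- Conjugate phases on F make every term equal to its absolute value; where m i j = 0 the quotient
  -- is 0.
  have hε : ∀ j, ‖if j ∈ F then (starRingEnd ℂ) (m i j) / ‖m i j‖ else 0‖ ≤ 1 := by
    intro j
    split_ifs
    · rw [norm_div, RCLike.norm_conj, Complex.norm_real, norm_norm]
      exact div_self_le_one _
    · simp
  let ε : BoundedContinuousFunction (ℕ × ℕ) ℂ :=
    BoundedContinuousFunction.ofNormedAddCommGroupDiscrete _ 1 hε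
  have hεn : ‖ε‖ ≤ 1 := (BoundedContinuousFunction.norm_le zero_le_one).2 hε
  have hval : Λ i ε = ((∑ j ∈ F, ‖m i j‖ : ℝ) : ℂ) := by
    rw [hΛ, tsum_eq_sum (s := F)]
    · rw [Complex.ofReal_sum]
      refine Finset.sum_congr rfl fun j hj => ?_
      have h1 : ε j = (starRingEnd ℂ) (m i j) / ‖m i j‖ := if_pos hj
      rw [h1, div_mul_eq_mul_div, mul_comm, Complex.mul_conj, Complex.normSq_eq_norm_sq]
      by_cases h0 : ‖m i j‖ = 0
      · simp [h0]
      · have h0' : ((‖m i j‖ : ℝ) : ℂ) ≠ 0 := by exact_mod_cast h0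
        push_cast
        field_simp
    · intro j hj
      have h1 : ε j = 0 := if_neg hj
      rw [h1, zero_mul]
  calc ∑ j ∈ F, ‖m i j‖ = ‖Λ i ε‖ := by
        rw [hval, Complex.norm_real, Real.norm_eq_abs,
          abs_of_nonneg (Finset.sum_nonneg fun _ _ => norm_nonneg _)]
    _ ≤ C * ‖ε‖ := (Λ i).le_of_opNorm_le (hC i) ε
    _ ≤ C := mul_le_of_le_one_right ((norm_nonneg _).trans (hC i)) hεn

/-- The kernel is not explicit: if every bounded choice of coefficients gave a bounded operator, the
sums of |m_j(ξ)| would be uniformly bounded, but N resonant scales contribute at least N G / 2. -/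
theorem exists_not_isL2Bounded (p : MvPolynomial (Fin 2) ℝ) {a b : ℕ} (ha : 0 < a)
    (hSa : ∀ n, (n, 0) ∈ exponents p → a ≤ n) (hSb : ∀ n, (0, n) ∈ exponents p → b ≤ n)
    {e : ℕ × ℕ} (he : e ∈ exponents p) (hlt : b * e.1 + a * e.2 < a * b) {a₀ : ℝ} (h : 0 < a₀)
    (ha₀ : a₀ ≤ 1) :
    ∃ K : 𝓓'((⊤ : Opens (ℝ × ℝ)), ℂ), IsProductKernel a₀ K ∧ ¬ IsL2Bounded (opT p K) := by
  by_contra! hall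
  have hP : Continuous (polyFun p) := (contDiff_polyFun p).continuous
  set m : ℝ → ℕ × ℕ → ℂ := fun ξ j => ∫ z, dilate j (dbumpProd h) z *
    Complex.exp (Complex.I * (ξ * polyFun p z : ℝ)) with hm
  obtain ⟨M, hamp⟩ := exists_isAmplitude_dbumpProd h
  have hsum : ∀ ξ, Summable fun j => ‖m ξ j‖ := by
    intro ξ
    have hφ : ContDiff ℝ 2 fun z => Complex.exp (Complex.I * (ξ * polyFun p z : ℝ)) :=
      Complex.contDiff_exp.comp (contDiff_const.mul (Complex.ofRealCLM.contDiff.comp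
        (contDiff_const.mul ((contDiff_polyFun p).of_le (WithTop.coe_le_coe.2 le_top)))))
    obtain ⟨D, hD⟩ := (isCompact_closedBall (0 : ℝ × ℝ) 1).exists_bound_of_continuousOn
      (hφ.continuous_iteratedFDeriv le_rfl).continuousOn
    exact Summable.of_nonneg_of_le (fun _ => norm_nonneg _)
      (norm_integral_dilate_dbumpProd_le h ha₀ hamp.bound hφ
        fun z hz => hD z (mem_closedBall_zero_iff.2 hz))
      (summable_half_mul_half.mul_left _)
  obtain ⟨C, hC⟩ := exists_sum_norm_le_of_forall_bounded hsum fun ε ⟨E, hE⟩ => by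
    have hfam := isKernelFamily_dbumpProd h hE
    obtain ⟨K, hK⟩ := exists_distribution h ha₀ hE
    obtain ⟨C, hC⟩ := exists_bound_of_isL2Bounded ha₀ hfam hK (hall K ⟨_, hfam, hK⟩)
    refine ⟨C, fun ξ => hC ξ _ ?_⟩
    have hs : Summable fun j => ε j * m ξ j :=
      Summable.of_norm_bounded ((hsum ξ).mul_left E) fun j => by
        rw [norm_mul]
        exact mul_le_mul_of_nonneg_right (hE j) (norm_nonneg _)
    refine hs.hasSum.congr_fun fun j => ?_
    simp only [hm, dilate_const_mul, mul_assoc]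
    exact integral_const_mul _ _
  obtain ⟨α, β, -, hβ, e₀, he₀, h1, h2, hmin⟩ := exists_strict_vertex ha hSa hSb he hlt
  set c : ℕ × ℕ → ℝ := fun e => coeffAt p e.1 e.2 with hc
  have hc0 : c e₀ ≠ 0 := mem_exponents.1 he₀
  obtain ⟨μ, hμ⟩ := exists_osc_dbumpProd_ne_zero h ha₀ hc0 h1 h2
  set G := ‖osc {e₀} c 1 1 μ (dbumpProd h)‖ with hG
  have hGpos : 0 < G := norm_pos_iff.2 hμ
  set A := |μ| * (∑ e ∈ exponents p, |c e|) with hA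
  have hA0 : 0 ≤ A := mul_nonneg (abs_nonneg _) (Finset.sum_nonneg fun _ _ => abs_nonneg _)
  have hlim : Tendsto (fun N : ℕ => 4 * (M * (A * (1 / 2 : ℝ) ^ N))) atTop (nhds 0) := by
    have := (tendsto_pow_atTop_nhds_zero_of_lt_one (r := (1 / 2 : ℝ)) (by norm_num)
      (by norm_num)).const_mul (4 * (M * A))
    rw [mul_zero] at this
    refine this.congr fun N => ?_
    ring
  have hbig : Tendsto (fun N : ℕ => (N : ℝ) * (G / 2)) atTop atTop :=
    tendsto_natCast_atTop_atTop.atTop_mul_const (by positivity)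
  -- N makes the error from the other monomials less than G / 2 and N G / 2 larger than C.
  obtain ⟨N, hN1, hN2⟩ := ((hlim.eventually_lt_const (half_pos hGpos)).and
    (hbig.eventually_gt_atTop C)).exists
  obtain ⟨L, F, hF, hscale⟩ := exists_scales hβ h2 hmin N
  have hlower : ∀ j ∈ F, G / 2 ≤ ‖m (μ * 2 ^ L) j‖ := by
    intro j hj
    obtain ⟨hL, hNj⟩ := hscale j hj
    have h3 := norm_osc_sub_osc_le c he₀ hL hNj μ (by linarith) hamp
    have h4 : m (μ * 2 ^ L) j = osc (exponents p) c (2 ^ j.1)⁻¹ (2 ^ j.2)⁻¹ (μ * 2 ^ L)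
        (dbumpProd h) :=
      integral_dilate_mul_exp p j _ (continuous_dbumpProd h) ⟨_, hamp.supp⟩
    rw [← h4, ← hA, norm_sub_rev] at h3
    have h5 := norm_sub_norm_le (osc {e₀} c 1 1 μ (dbumpProd h)) (m (μ * 2 ^ L) j)
    rw [← hG] at h5
    linarith
  have h6 := Finset.card_nsmul_le_sum F _ _ hlower
  rw [hF, nsmul_eq_mul] at h6
  exact absurd (hC (μ * 2 ^ L) F) (not_le.2 (hN2.trans_le h6))

theorem one_le_div_add_div_iff {a b : ℕ} (ha : 0 < a) (hb : 0 < b) (e f : ℕ) :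
    1 ≤ (e : ℝ) / a + (f : ℝ) / b ↔ a * b ≤ b * e + a * f := by
  have ha' : (0 : ℝ) < a := by exact_mod_cast ha
  have hb' : (0 : ℝ) < b := by exact_mod_cast hb
  rw [div_add_div _ _ ha'.ne' hb'.ne', one_le_div (by positivity), mul_comm (e : ℝ)]
  exact_mod_cast Iff.rfl

end TransInv

theorem theorem17p6 (p : MvPolynomial (Fin 2) ℝ) (hp : TransInv.coeffAt p 0 0 = 0) (a b : ℕ)
    (ha : IsLeast {n : ℕ | 0 < n ∧ TransInv.coeffAt p n 0 ≠ 0} a)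
    (hb : IsLeast {n : ℕ | 0 < n ∧ TransInv.coeffAt p 0 n ≠ 0} b) :
    (∃ a₀ : ℝ, 0 < a₀ ∧ a₀ ≤ 1 ∧ ∀ K : 𝓓'((⊤ : Opens (ℝ × ℝ)), ℂ),
        TransInv.IsProductKernel a₀ K → TransInv.IsL2Bounded (TransInv.opT p K)) ↔
      ∀ e f : ℕ, TransInv.coeffAt p e f ≠ 0 → 1 ≤ (e : ℝ) / a + (f : ℝ) / b := by
  open TransInv in
  have ha0 : 0 < a := ha.1.1
  have hb0 : 0 < b := hb.1.1
  constructor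
  · rintro ⟨a₀, h0, h1, hK⟩ e f hef
    rw [one_le_div_add_div_iff ha0 hb0]
    by_contra! hlt
    -- The absence of a constant term excludes n = 0, so minimality of a and b applies to all
    -- exponents on the axes.
    have hpos : ∀ n, coeffAt p n 0 ≠ 0 → 0 < n := fun n hn =>
      Nat.pos_of_ne_zero fun h => hn (h ▸ hp)
    have hpos' : ∀ n, coeffAt p 0 n ≠ 0 → 0 < n := fun n hn =>
      Nat.pos_of_ne_zero fun h => hn (h ▸ hp)
    obtain ⟨K, hKp, hKn⟩ := exists_not_isL2Bounded p (e := (e, f)) ha0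
      (fun n hn => ha.2 ⟨hpos n (mem_exponents.1 hn), mem_exponents.1 hn⟩)
      (fun n hn => hb.2 ⟨hpos' n (mem_exponents.1 hn), mem_exponents.1 hn⟩)
      (mem_exponents.2 hef) hlt h0 h1
    exact hKn (hK K hKp)
  · intro h
    exact exists_forall_isL2Bounded p
      { pos_left := ha0
        pos_right := hb0
        above := fun e he => (one_le_div_add_div_iff ha0 hb0 _ _).1 (h _ _ (mem_exponents.1 he))
        mem_left := mem_exponents.2 ha.1.2
        mem_right := mem_exponents.2 hb.1.2
        ne_left := ha.1.2
        ne_right := hb.1.2 }
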